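/- Let $n\ge 1$ be an integer. Let $T_n$ be the $n$-branching tree: its vertices are the finite words (including the empty word $\emptyset$) in the letters $1,\dots,n$, two words are adjacent if one is obtained from the other by adding one letter at its end, and $d$ is the shortest-path metric. Write $|x|$ for the length of a word $x$ and put $h(x)=d(x,\emptyset)=|x|$. For a branch $\bar x=(x_i)_{i\ge1}\in\{1,\dots,n\}^{\mathbb N}$ and $k\ge 0$ let $\bar x|k=(x_1,\dots,x_k)$ and let $\bar x|k^\smallfrown T_n$ be the set of words in $T_n$ which start with $\bar x|k$. Let $\mathrm C^*_u(T_n)\subseteq\mathcal B(\ell_2(T_n))$ be the uniform Roe algebra, i.e. the norm closure of the $*$-algebra of all bounded operators $a$ with $\sup\{d(x,y) : a_{x,y}\neq 0\}<\infty$, where $a_{x,y}=\langle a\delta_y,\delta_x\rangle$. For $A\subseteq T_n$ let $\chi_A\in \mathrm C^*_u(T_n)$ be the projection of $\ell_2(T_n)$ onto $\ell_2(A)$. Let $\bar h$ be the diagonal operator with entries $h(x)$, and let $\sigma_{h,t}(a)=e^{it\bar h}ae^{-it\bar h}$ for $a\in\mathrm C^*_u(T_n)$, $t\in\mathbb R$.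 For $\beta\in\mathbb R$, a $(\sigma_h,\beta)$-KMS state is a state $\varphi$ on $\mathrm C^*_u(T_n)$ with $\varphi(a\,\sigma_{h,i\beta}(b))=\varphi(ba)$ for all $a\in\mathrm C^*_u(T_n)$ and all analytic $b$, i.e. all $b\in\mathrm C^*_u(T_n)$ such that $t\mapsto\sigma_{h,t}(b)$ extends to an entire map $z\mapsto\sigma_{h,z}(b)$ from $\mathbb C$ to $\mathrm C^*_u(T_n)$. A KMS state is extreme if it is an extreme point of the convex set of all $(\sigma_h,\beta)$-KMS states. A state on $\mathrm C^*_u(T_n)$ is called strongly continuous if it is continuous for the strong operator topology on norm-bounded subsets of $\mathrm C^*_u(T_n)$. Then: 1. For $\beta\in\mathbb R$, there is a $(\sigma_h,\beta)$-KMS state on $\mathrm C^*_u(T_n)$ if and only if $\beta\ge\log n$. 2. For $\beta>\log n$ there is a unique $(\sigma_h,\beta)$-KMS state $\varphi_\beta$ on $\mathrm C^*_u(T_n)$; it is strongly continuous and is given by $$\varphi_\beta(a)=\sum_{y\in T_n}a_{y,y}\bigl(e^{-\beta|y|}-n\,e^{-\beta(|y|+1)}\bigr)\quad\text{for all } a\in\mathrm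 C^*_u(T_n).$$ 3. For $\beta=\log n$: (a) every $(\sigma_h,\beta)$-KMS state on $\mathrm C^*_u(T_n)$ vanishes on the compact operators; (b) for every extreme $(\sigma_h,\beta)$-KMS state $\varphi$ there is exactly one branch $\bar x$ such that $\varphi(\chi_{\bar x|k^\smallfrown T_n})=1$ for all $k$; (c) for every branch $\bar x$, the set of extreme $(\sigma_h,\beta)$-KMS states $\varphi$ with $\varphi(\chi_{\bar x|k^\smallfrown T_n})=1$ for all $k$ has cardinality exactly $2^{2^{\aleph_0}}$; (d) the set of all extreme $(\sigma_h,\beta)$-KMS states has cardinality exactly $2^{2^{\aleph_0}}$. -/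

import Mathlib

open scoped ENNReal ComplexOrder

noncomputable section

/-! ### Operators on `ℓ²(X)` -/

/-- The Hilbert space `ℓ₂(X)` of square-summable complex families indexed by `X`. -/
abbrev Ell2 (X : Type*) : Type _ := lp (fun _ : X => ℂ) 2

/-- The algebra `𝓑(ℓ₂(X))` of bounded operators. -/
abbrev BEll2 (X : Type*) : Type _ := Ell2 X →L[ℂ] Ell2 X

/-- The canonical basis vector `δ_x`. -/
def deltaVec {X : Type*} (x : X) : Ell2 X := by
  classical exact lp.single 2 x (1 : ℂ)

/-- The matrix entry `a_{x,y} = ⟨a δ_y, δ_x⟩` (linear in the first variable),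
i.e. the `x`-th coordinate of `a δ_y`. -/
def matEntry {X : Type*} (a : BEll2 X) (x y : X) : ℂ := a (deltaVec y) x

theorem inner_deltaVec {X : Type*} (x : X) (f : Ell2 X) : inner ℂ (deltaVec x) f = f x := by
  classical
  simp [deltaVec, lp.inner_single_left]

theorem matEntry_eq_inner {X : Type*} (a : BEll2 X) (x y : X) :
    matEntry a x y = inner ℂ (deltaVec x) (a (deltaVec y)) :=
  (inner_deltaVec _ _).symm

theorem deltaVec_apply {X : Type*} [DecidableEq X] (x y : X) :
    (deltaVec x : Ell2 X) y = if y = x then 1 else 0 := by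
  unfold deltaVec
  by_cases h : y = x
  · subst h; simp
  · simp [lp.single_apply, h]

theorem matEntry_star {X : Type*} (a : BEll2 X) (x y : X) :
    matEntry (star a) x y = star (matEntry a y x) := by
  rw [matEntry_eq_inner, matEntry_eq_inner, ContinuousLinearMap.star_eq_adjoint,
    ContinuousLinearMap.adjoint_inner_right]
  exact (inner_conj_symm _ _).symm

theorem hasSum_smul_deltaVec {X : Type*} (f : Ell2 X) :
    HasSum (fun x => f x • deltaVec x) f := by
  classical
  have h := lp.hasSum_single (E := fun _ : X => ℂ) (p := 2) (by simp) f
  convert h using 2 with x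
  rw [deltaVec, ← lp.single_smul]
  simp

theorem matEntry_mul {X : Type*} (a b : BEll2 X) (x y : X) :
    HasSum (fun z => matEntry b z y * matEntry a x z) (matEntry (a * b) x y) := by
  have h := (hasSum_smul_deltaVec (b (deltaVec y))).mapL a
  have h' := h.mapL (innerSL ℂ (deltaVec x : Ell2 X))
  simpa [inner_deltaVec, inner_smul_right, matEntry] using h'

theorem memℓp_mul_of_bound {X : Type*} {c : X → ℂ} {C : ℝ} (hc : ∀ x, ‖c x‖ ≤ C) (f : Ell2 X) :
    Memℓp (fun x => c x * f x) 2 := by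
  have h := ((lp.memℓp f).const_mul (C : ℂ))
  refine h.mono' fun x => ?_
  simp only [norm_mul, Complex.norm_real]
  exact mul_le_mul_of_nonneg_right ((hc x).trans (le_abs_self C)) (norm_nonneg _)

/-- A bounded family `c ∈ ℓ_∞(X)` as a diagonal operator: `(c ξ)_x = c_x ξ_x`. -/
def diagOp {X : Type*} (c : X → ℂ) {C : ℝ} (hc : ∀ x, ‖c x‖ ≤ C) : BEll2 X :=
  LinearMap.mkContinuous
    { toFun := fun f => ⟨fun x => c x * f x, memℓp_mul_of_bound hc f⟩
      map_add' := fun f g => by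
        ext x
        exact mul_add _ _ _
      map_smul' := fun r f => by
        ext x
        simp [mul_left_comm] }
    |C| (fun f => by
      have h2 : (0 : ℝ) < (2 : ℝ≥0∞).toReal := by simp
      refine lp.norm_le_of_forall_sum_le h2 (by positivity) fun s => ?_
      rw [Real.mul_rpow (abs_nonneg _) (norm_nonneg _)]
      refine le_trans ?_ (mul_le_mul_of_nonneg_left (lp.sum_rpow_le_norm_rpow h2 f s)
        (Real.rpow_nonneg (abs_nonneg _) _))
      rw [Finset.mul_sum]
      refine Finset.sum_le_sum fun x _ => ?_
      rw [← Real.mul_rpow (abs_nonneg _) (norm_nonneg _)]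
      refine Real.rpow_le_rpow (norm_nonneg _) ?_ h2.le
      simp only [LinearMap.coe_mk, AddHom.coe_mk, norm_mul]
      exact mul_le_mul_of_nonneg_right ((hc x).trans (le_abs_self C)) (norm_nonneg _))

theorem diagOp_apply {X : Type*} (c : X → ℂ) {C : ℝ} (hc : ∀ x, ‖c x‖ ≤ C) (f : Ell2 X) (x : X) :
    diagOp c hc f x = c x * f x := rfl

theorem diagOp_deltaVec {X : Type*} (c : X → ℂ) {C : ℝ} (hc : ∀ x, ‖c x‖ ≤ C) (y : X) :
    diagOp c hc (deltaVec y) = c y • deltaVec y := by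
  classical
  ext x
  rw [diagOp_apply]
  by_cases h : x = y
  · subst h; simp
  · simp [deltaVec_apply, h]

theorem matEntry_diagOp_mul_mul {X : Type*} (c d : X → ℂ) {C D : ℝ} (hc : ∀ x, ‖c x‖ ≤ C)
    (hd : ∀ x, ‖d x‖ ≤ D) (a : BEll2 X) (x y : X) :
    matEntry (diagOp c hc * a * diagOp d hd) x y = c x * matEntry a x y * d y := by
  simp only [matEntry, mul_apply_eq_comp, diagOp_deltaVec, map_smul, diagOp_apply,
    lp.coeFn_smul, Pi.smul_apply, smul_eq_mul]
  ring

/-! ### Uniform Roe algebras -/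

/-- The operator `a` has finite propagation. -/
def HasFinitePropagation {X : Type*} [MetricSpace X] (a : BEll2 X) : Prop :=
  ∃ r : ℝ, ∀ x y : X, matEntry a x y ≠ 0 → dist x y ≤ r

/-- The algebraic uniform Roe algebra `C*_u[X]`: the `*`-algebra of all operators of finite
propagation. -/
def algebraicRoeAlgebra (X : Type*) [MetricSpace X] : StarSubalgebra ℂ (BEll2 X) where
  carrier := {a | HasFinitePropagation a}
  mul_mem' := by
    rintro a b ⟨r, hr⟩ ⟨s, hs⟩
    refine ⟨r + s, fun x y h => ?_⟩
    have : ∃ z, matEntry b z y * matEntry a x z ≠ 0 := by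
      by_contra! hz
      exact h ((matEntry_mul a b x y).unique (by simp [hz]))
    obtain ⟨z, hz⟩ := this
    exact (dist_triangle x z y).trans
      (add_le_add (hr x z (right_ne_zero_of_mul hz)) (hs z y (left_ne_zero_of_mul hz)))
  add_mem' := by
    rintro a b ⟨r, hr⟩ ⟨s, hs⟩
    refine ⟨max r s, fun x y h => ?_⟩
    by_cases ha : matEntry a x y = 0
    · refine le_max_of_le_right (hs x y fun hb => h ?_)
      have : matEntry (a + b) x y = matEntry a x y + matEntry b x y := rfl
      rw [this, ha, hb, add_zero]
    · exact le_max_of_le_left (hr x y ha)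
  algebraMap_mem' := fun c => by
    classical
    refine ⟨0, fun x y h => ?_⟩
    by_cases hxy : x = y
    · simp [hxy]
    · refine absurd ?_ h
      have : matEntry (algebraMap ℂ (BEll2 X) c) x y = c * (deltaVec y : Ell2 X) x := rfl
      rw [this, deltaVec_apply, if_neg hxy, mul_zero]
  star_mem' := by
    rintro a ⟨r, hr⟩
    refine ⟨r, fun x y h => ?_⟩
    rw [dist_comm]
    refine hr y x fun h0 => h ?_
    rw [matEntry_star, h0, star_zero]

/-- The uniform Roe algebra `C*_u(X)`: the norm closure of `C*_u[X]` in `𝓑(ℓ₂(X))`. -/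
def uniformRoeAlgebra (X : Type*) [MetricSpace X] : StarSubalgebra ℂ (BEll2 X) :=
  (algebraicRoeAlgebra X).topologicalClosure

theorem diagOp_mem {X : Type*} [MetricSpace X] (c : X → ℂ) {C : ℝ} (hc : ∀ x, ‖c x‖ ≤ C) :
    diagOp c hc ∈ algebraicRoeAlgebra X := by
  classical
  refine ⟨0, fun x y h => ?_⟩
  by_cases hxy : x = y
  · simp [hxy]
  · refine absurd ?_ h
    rw [matEntry, diagOp_apply, deltaVec_apply, if_neg hxy, mul_zero]

theorem diagOp_mem_uniformRoeAlgebra {X : Type*} [MetricSpace X] (c : X → ℂ) {C : ℝ}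
    (hc : ∀ x, ‖c x‖ ≤ C) : diagOp c hc ∈ uniformRoeAlgebra X :=
  StarSubalgebra.le_topologicalClosure _ (diagOp_mem c hc)

theorem norm_indicator_one_le {X : Type*} (S : Set X) (x : X) :
    ‖S.indicator (fun _ => (1 : ℂ)) x‖ ≤ 1 :=
  (norm_indicator_le_norm_self _ _).trans (by simp)

/-- The projection `χ_S` of `ℓ₂(X)` onto `ℓ₂(S)`, as an element of `C*_u(X)`. -/
def roeProj {X : Type*} [MetricSpace X] (S : Set X) : uniformRoeAlgebra X :=
  ⟨diagOp (S.indicator fun _ => (1 : ℂ)) (norm_indicator_one_le S),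
    diagOp_mem_uniformRoeAlgebra _ _⟩

theorem norm_exp_I_mul_le {X : Type*} (h : X → ℝ) (t : ℝ) (x : X) :
    ‖Complex.exp (((t * h x : ℝ) : ℂ) * Complex.I)‖ ≤ 1 :=
  (Complex.norm_exp_ofReal_mul_I _).le

/-- The unitary diagonal operator `e^{i t h̄}`. -/
def expDiag {X : Type*} (h : X → ℝ) (t : ℝ) : BEll2 X :=
  diagOp (fun x => Complex.exp (((t * h x : ℝ) : ℂ) * Complex.I)) (norm_exp_I_mul_le h t)

/-- The flow `σ_{h,t}(a) = e^{i t h̄} a e^{-i t h̄}` on `C*_u(X)`. -/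
def roeFlow {X : Type*} [MetricSpace X] (h : X → ℝ) (t : ℝ) (a : uniformRoeAlgebra X) :
    uniformRoeAlgebra X :=
  ⟨expDiag h t * (a : BEll2 X) * expDiag h (-t),
    mul_mem (mul_mem (diagOp_mem_uniformRoeAlgebra _ _) a.2) (diagOp_mem_uniformRoeAlgebra _ _)⟩

/-! ### States and the KMS condition -/

/-- A state on a unital C*-algebra: a positive linear functional of norm one, i.e. a positive
functional with value `1` at the unit. -/
def IsState {A : Type*} [NormedRing A] [StarRing A] [NormedAlgebra ℂ A] (φ : A →L[ℂ] ℂ) : Prop :=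
  (∀ a : A, 0 ≤ φ (star a * a)) ∧ φ 1 = 1

/-- `F : ℂ → A` is an entire extension of the orbit `t ↦ σ_t(b)`; the element `b` is analytic for
`σ` when there is such an `F`, and then `F z` is what is denoted `σ_z(b)` (the extension is unique
by the identity theorem). -/
def IsEntireExtension {A : Type*} [NormedRing A] [NormedAlgebra ℂ A]
    (σ : ℝ → A → A) (b : A) (F : ℂ → A) : Prop :=
  Differentiable ℂ F ∧ ∀ t : ℝ, F t = σ t b

/-- `φ` is a `(σ, β)`-KMS state: `φ(a σ_{iβ}(b)) = φ(b a)` for every `a` and every analytic `b`. -/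
def IsKMSState {A : Type*} [NormedRing A] [StarRing A] [NormedAlgebra ℂ A]
    (σ : ℝ → A → A) (β : ℝ) (φ : A →L[ℂ] ℂ) : Prop :=
  IsState φ ∧ ∀ (a b : A) (F : ℂ → A), IsEntireExtension σ b F →
    φ (a * F (Complex.I * β)) = φ (b * a)

/-- The functional `φ` on `C*_u(X)` is strongly continuous on bounded sets: if a bounded net `b`
in `C*_u(X)` converges to `a ∈ C*_u(X)` in the strong operator topology, then `φ(b)` converges
to `φ(a)`. Nets in `C*_u(X)` are expressed by filters. -/
def IsStronglyContinuous {X : Type*} [MetricSpace X] (φ : uniformRoeAlgebra X →L[ℂ] ℂ) : Prop :=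
  ∀ (l : Filter (uniformRoeAlgebra X)) (a : uniformRoeAlgebra X) (r : ℝ),
    (∀ᶠ b in l, ‖b‖ ≤ r) →
    (∀ ξ : Ell2 X, Filter.Tendsto (fun b : uniformRoeAlgebra X => (b : BEll2 X) ξ) l
      (nhds ((a : BEll2 X) ξ))) →
    Filter.Tendsto φ l (nhds (φ a))

/-- The functional `φ` on `C*_u(X)` vanishes on the compact operators. -/
def VanishesOnCompacts {X : Type*} [MetricSpace X] (φ : uniformRoeAlgebra X →L[ℂ] ℂ) : Prop :=
  ∀ a : uniformRoeAlgebra X, IsCompactOperator (a : BEll2 X) → φ a = 0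

/-! ### The `n`-branching tree -/

/-- The vertices of the `n`-branching tree: finite words in `n` letters (a word is written
from left to right). -/
def BranchingTree (n : ℕ) : Type := List (Fin n)

namespace BranchingTree

variable {n : ℕ}

/-- The empty word. -/
def root (n : ℕ) : BranchingTree n := ([] : List (Fin n))

/-- The word `w` with the letter `k` added at its end. -/
def snoc (w : BranchingTree n) (k : Fin n) : BranchingTree n := List.append w [k]

/-- The length `|w|` of a word. -/
def length (w : BranchingTree n) : ℕ := List.length w

/-- Two words are adjacent if one is the other one with a letter added at its end. -/
def graph (n : ℕ) : SimpleGraph (BranchingTree n) where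
  Adj v w := ∃ k : Fin n, v = snoc w k ∨ w = snoc v k
  symm := ⟨fun _ _ ⟨k, hk⟩ => ⟨k, hk.symm⟩⟩
  loopless := ⟨fun w ⟨k, hk⟩ => by
    have h : w = snoc w k := hk.elim id id
    have h' := congrArg length h
    have h'' : (List.append w [k]).length = List.length w + 1 := List.length_append
    change List.length w = (List.append w [k]).length at h'
    omega⟩

theorem graph_connected (n : ℕ) : (graph n).Connected := by
  have key : ∀ w : List (Fin n), (graph n).Reachable (root n) w := by
    intro w
    induction w using List.reverseRecOn with
    | nil => exact SimpleGraph.Reachable.refl _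
    | append_singleton w k ih =>
      refine ih.trans (SimpleGraph.Adj.reachable ?_)
      exact ⟨k, Or.inr rfl⟩
  have : Nonempty (BranchingTree n) := ⟨root n⟩
  exact SimpleGraph.Connected.mk fun v w => (key v).symm.trans (key w)

/-- The shortest path metric. -/
instance (n : ℕ) : MetricSpace (BranchingTree n) where
  dist v w := ((graph n).dist v w : ℝ)
  dist_self v := by simp
  dist_comm v w := by rw [SimpleGraph.dist_comm]
  dist_triangle u v w := by exact_mod_cast (graph_connected n).dist_triangle
  eq_of_dist_eq_zero {v w} h := (graph_connected n).dist_eq_zero_iff.1 (by exact_mod_cast h)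

/-- The function `h(x) = d(x, ∅)`. -/
def height (x : BranchingTree n) : ℝ := dist x (root n)

/-- The set of words that start with the first `k` letters of the branch `x`. -/
def branchCone (x : ℕ → Fin n) (k : ℕ) : Set (BranchingTree n) :=
  {w | ∃ z : List (Fin n), w = List.append (List.ofFn fun i : Fin k => x i) z}

/-- The set of `(σ_h, β)`-KMS states on the uniform Roe algebra of the `n`-branching tree, as a
subset of the dual Banach space. -/
def kmsStates (n : ℕ) (β : ℝ) : Set (uniformRoeAlgebra (BranchingTree n) →L[ℂ] ℂ) :=
  {φ | IsKMSState (roeFlow height) β φ}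

/-- The extreme points of the convex set of `(σ_h, β)`-KMS states. -/
def extremeKMSStates (n : ℕ) (β : ℝ) : Set (uniformRoeAlgebra (BranchingTree n) →L[ℂ] ℂ) :=
  (kmsStates n β).extremePoints ℝ

/-- `φ` is concentrated along the branch `x`: `φ(χ_{x|k ⌢ T_n}) = 1` for all `k`. -/
def ConcentratedOn (φ : uniformRoeAlgebra (BranchingTree n) →L[ℂ] ℂ) (x : ℕ → Fin n) : Prop :=
  ∀ k : ℕ, φ (roeProj (branchCone x k)) = 1

end BranchingTree

end

/-! A KMS state is determined by its restriction to the diagonal algebra ℓ_∞(T_n). Diagonal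
operators are fixed by the flow, hence can be moved cyclically under the state, and an operator of
finite propagation becomes diagonal when it is cut down by each class of a suitable finite colouring
(`apply_eq_apply_roeDiag_roeExpect`). On the diagonal, the KMS condition for the isometries δ_x ↦
δ_{x⌢k} says that appending a letter scales the functional by e^{-β}
(`isConformal_of_mem_kmsStates`). Conversely, every such conformal functional composed with the
diagonal expectation is KMS (`IsConformal.comp_roeExpect_mem_kmsStates`). The theorem thus concerns
finitely additive conformal probability measures on T_n.

The unit is the root plus n shifted copies of the unit, so the root has mass 1 - n e^{-β}, and
positivity gives β ≥ log n. For β > log n the point masses add up to 1, no mass is left at infinity,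
and the state is the given sum (`IsConformal.hasSum`). For β = log n finite sets are null. Hence
compact operators are killed, and conditioning on a set that is invariant up to finitely many words
preserves conformality. Extreme states therefore take only the values 0 and 1 on such sets
(`IsAlmostInvariant.apply_eq_zero_or_one`); applied to cones, this singles out a branch.

For the cardinality, conformality at log n follows from invariance under the Markov operator that
appends a uniformly random letter. Averages over long windows of levels below a vertex of the branch
are almost invariant. Their limit along a free ultrafilter ω is conformal, is concentrated on the
branch, and remembers ω because different windows occupy disjoint blocks of levels
(`exists_isConformal_of_ultrafilter`). The KMS states that remember ω and the branch form a nonempty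
weak-* compact extreme subset, which has an extreme point by Krein-Milman. Different ω give
different extreme states, there are at least 2^{2^{ℵ₀}} free ultrafilters on ℕ, and the whole dual
space is no larger than this. -/

noncomputable section

/-! ### Bounded families and diagonal operators -/

/-- The space `ℓ_∞(X)` of bounded complex families. -/
abbrev EllInf (X : Type*) : Type _ := lp (fun _ : X => ℂ) ∞

namespace EllInf

variable {X : Type*}

/-- A bounded family as an element of `ℓ_∞(X)`. -/
def mk (f : X → ℂ) {C : ℝ} (hf : ∀ x, ‖f x‖ ≤ C) : EllInf X :=
  ⟨f, memℓp_infty ⟨C, by rintro _ ⟨x, rfl⟩; exact hf x⟩⟩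

@[simp]
theorem mk_apply (f : X → ℂ) {C : ℝ} (hf : ∀ x, ‖f x‖ ≤ C) (x : X) : mk f hf x = f x := rfl

theorem norm_apply_le (f : EllInf X) (x : X) : ‖f x‖ ≤ ‖f‖ :=
  lp.norm_apply_le_norm (by simp) f x

theorem norm_le {f : EllInf X} {C : ℝ} (hC : 0 ≤ C) (h : ∀ x, ‖f x‖ ≤ C) : ‖f‖ ≤ C :=
  lp.norm_le_of_forall_le hC h

@[simp]
theorem one_apply (x : X) : (1 : EllInf X) x = 1 := by
  rw [lp.infty_coeFn_one]; rfl

@[simp]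
theorem mul_apply (f g : EllInf X) (x : X) : (f * g) x = f x * g x := by
  rw [lp.infty_coeFn_mul]; rfl

@[simp]
theorem add_apply (f g : EllInf X) (x : X) : (f + g) x = f x + g x := by
  rw [lp.coeFn_add]; rfl

@[simp]
theorem sub_apply (f g : EllInf X) (x : X) : (f - g) x = f x - g x := by
  rw [lp.coeFn_sub]; rfl

@[simp]
theorem smul_apply (c : ℂ) (f : EllInf X) (x : X) : (c • f) x = c * f x := by
  rw [lp.coeFn_smul]; rfl

theorem sum_apply {ι : Type*} (s : Finset ι) (f : ι → EllInf X) (x : X) :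
    (∑ i ∈ s, f i) x = ∑ i ∈ s, f i x := by
  rw [lp.coeFn_sum, Finset.sum_apply]

/-- The indicator function of a set. -/
def ind (S : Set X) : EllInf X := mk (S.indicator fun _ => (1 : ℂ)) (norm_indicator_one_le S)

theorem ind_apply (S : Set X) (x : X) : ind S x = S.indicator (fun _ => (1 : ℂ)) x := rfl

theorem ind_of_mem {S : Set X} {x : X} (h : x ∈ S) : ind S x = 1 := by simp [ind_apply, h]

theorem ind_of_notMem {S : Set X} {x : X} (h : x ∉ S) : ind S x = 0 := by simp [ind_apply, h]

theorem ind_singleton_self (x : X) : ind {x} x = 1 := ind_of_mem (Set.mem_singleton x)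

theorem ind_singleton_of_ne {x y : X} (h : y ≠ x) : ind {x} y = 0 := ind_of_notMem h

theorem ind_nonneg (S : Set X) (x : X) : 0 ≤ ind S x := by
  by_cases h : x ∈ S
  · rw [ind_of_mem h]; exact zero_le_one
  · rw [ind_of_notMem h]

/-- Evaluation at a point. -/
def eval (x : X) : EllInf X →L[ℂ] ℂ :=
  LinearMap.mkContinuous
    { toFun := fun f => f x
      map_add' := fun f g => add_apply f g x
      map_smul' := fun c f => smul_apply c f x } 1
    (fun f => by rw [one_mul]; exact norm_apply_le f x)

@[simp]
theorem eval_apply (x : X) (f : EllInf X) : eval x f = f x := rfl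

/-- A functional which is nonnegative on pointwise nonnegative families. -/
def IsPositive (m : EllInf X →L[ℂ] ℂ) : Prop := ∀ f : EllInf X, (∀ x, 0 ≤ f x) → 0 ≤ m f

theorem IsPositive.mono {m : EllInf X →L[ℂ] ℂ} (hm : IsPositive m) {f g : EllInf X}
    (h : ∀ x, f x ≤ g x) : m f ≤ m g := by
  have := hm (g - f) fun x => by rw [sub_apply]; exact sub_nonneg.2 (h x)
  rw [map_sub] at this
  exact sub_nonneg.1 this

theorem norm_re_le (f : EllInf X) (x : X) : ‖((f x).re : ℂ)‖ ≤ ‖f‖ := by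
  rw [Complex.norm_real]
  exact (Complex.abs_re_le_norm _).trans (norm_apply_le f x)

theorem norm_im_le (f : EllInf X) (x : X) : ‖((f x).im : ℂ)‖ ≤ ‖f‖ := by
  rw [Complex.norm_real]
  exact (Complex.abs_im_le_norm _).trans (norm_apply_le f x)

theorem IsPositive.norm_le_of_real {m : EllInf X →L[ℂ] ℂ} (hm : IsPositive m) {f g : EllInf X}
    (r s : X → ℝ) (hf : ∀ x, f x = r x) (hg : ∀ x, g x = s x) (h : ∀ x, |r x| ≤ s x) :
    ‖m f‖ ≤ (m g).re := by
  have h1 := hm.mono (f := f) (g := g) fun x => by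
    rw [hf, hg]; exact Complex.real_le_real.2 ((le_abs_self _).trans (h x))
  have h2 := hm.mono (f := -f) (g := g) fun x => by
    rw [lp.coeFn_neg, Pi.neg_apply, hf, hg, ← Complex.ofReal_neg]
    exact Complex.real_le_real.2 ((neg_le_abs _).trans (h x))
  have h3 := hm g fun x => by
    rw [hg]; exact Complex.zero_le_real.2 ((abs_nonneg _).trans (h x))
  rw [map_neg] at h2
  rw [Complex.le_def] at h1 h2 h3
  simp only [Complex.neg_re, Complex.neg_im, Complex.zero_re, Complex.zero_im] at h1 h2 h3
  have him : (m f).im = 0 := by rw [h1.2]; exact h3.2.symm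
  have : m f = ((m f).re : ℂ) := Complex.ext rfl (by simp [him])
  rw [this, Complex.norm_real, Real.norm_eq_abs, abs_le]
  constructor <;> linarith [h1.1, h2.1]

/-- The factor 2 comes from treating real and imaginary parts separately. It is not optimal, but
only boundedness and smallness are ever needed. -/
theorem IsPositive.norm_le_two_mul {m : EllInf X →L[ℂ] ℂ} (hm : IsPositive m) {f g : EllInf X}
    (s : X → ℝ) (hg : ∀ x, g x = s x) (h : ∀ x, ‖f x‖ ≤ s x) :
    ‖m f‖ ≤ 2 * (m g).re := by
  have hd : f = mk (fun x => ((f x).re : ℂ)) (norm_re_le f) +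
      Complex.I • mk (fun x => ((f x).im : ℂ)) (norm_im_le f) := by
    ext x
    simp [mul_comm Complex.I]
  have h1 := hm.norm_le_of_real (f := mk (fun x => ((f x).re : ℂ)) (norm_re_le f)) (g := g)
    (fun x => (f x).re) s (fun _ => rfl) hg fun x => (Complex.abs_re_le_norm _).trans (h x)
  have h2 := hm.norm_le_of_real (f := mk (fun x => ((f x).im : ℂ)) (norm_im_le f)) (g := g)
    (fun x => (f x).im) s (fun _ => rfl) hg fun x => (Complex.abs_im_le_norm _).trans (h x)
  rw [hd, map_add, map_smul]
  refine (norm_add_le _ _).trans ?_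
  rw [norm_smul, Complex.norm_I, one_mul]
  linarith

/-- This controls a functional by the mass of a support set: null sets can be ignored, and sets of
small mass contribute little. -/
theorem IsPositive.norm_apply_le_norm_mul_ind {m : EllInf X →L[ℂ] ℂ} (hm : IsPositive m)
    {f : EllInf X} {C : ℝ} {S : Set X} (hC : ∀ x, ‖f x‖ ≤ C) (hS : ∀ x, x ∉ S → f x = 0) :
    ‖m f‖ ≤ 2 * (C * (m (ind S)).re) := by
  have h := hm.norm_le_two_mul (f := f) (g := (C : ℂ) • ind S)
    (fun x => C * S.indicator (fun _ => (1 : ℝ)) x)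
    (fun x => by
      rw [smul_apply, ind_apply]
      by_cases hx : x ∈ S <;> simp [hx])
    (fun x => by
      by_cases hx : x ∈ S
      · simpa [hx] using hC x
      · simp [hx, hS x hx])
  rwa [map_smul, smul_eq_mul, Complex.re_ofReal_mul] at h

theorem IsPositive.norm_le {m : EllInf X →L[ℂ] ℂ} (hm : IsPositive m) (h1 : m 1 = 1)
    (f : EllInf X) : ‖m f‖ ≤ 2 * ‖f‖ := by
  have h := hm.norm_apply_le_norm_mul_ind (f := f) (S := Set.univ) (norm_apply_le f)
    (fun x hx => absurd (Set.mem_univ x) hx)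
  have hu : ind (Set.univ : Set X) = 1 := by
    ext x; rw [ind_of_mem (Set.mem_univ x), one_apply]
  rwa [hu, h1, Complex.one_re, mul_one] at h

theorem ind_compl (S : Set X) : ind Sᶜ = 1 - ind S := by
  ext x
  by_cases h : x ∈ S
  · rw [ind_of_notMem (by simpa using h), sub_apply, one_apply, ind_of_mem h, sub_self]
  · rw [ind_of_mem h, sub_apply, one_apply, ind_of_notMem h, sub_zero]

theorem ind_union {S T : Set X} (h : Disjoint S T) : ind (S ∪ T) = ind S + ind T := by
  ext x
  rw [add_apply, ind_apply, ind_apply, ind_apply, Set.indicator_union_of_disjoint h]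

theorem ind_le (S : Set X) (x : X) : ind S x ≤ 1 := by
  by_cases h : x ∈ S
  · rw [ind_of_mem h]
  · rw [ind_of_notMem h]; exact zero_le_one

end EllInf

theorem matEntry_ext {X : Type*} {a b : BEll2 X} (h : ∀ x y, matEntry a x y = matEntry b x y) :
    a = b := by
  ext1 f
  have ha := (hasSum_smul_deltaVec f).mapL a
  have hb := (hasSum_smul_deltaVec f).mapL b
  refine ha.unique ?_
  convert hb using 2 with x
  rw [map_smul, map_smul]
  congr 1
  ext y
  exact h y x

theorem norm_deltaVec {X : Type*} (x : X) : ‖(deltaVec x : Ell2 X)‖ = 1 := by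
  classical
  rw [deltaVec, lp.norm_single (by simp)]
  simp

theorem norm_matEntry_le {X : Type*} (a : BEll2 X) (x y : X) : ‖matEntry a x y‖ ≤ ‖a‖ := by
  refine (lp.norm_apply_le_norm (by simp) _ x).trans ((a.le_opNorm _).trans ?_)
  rw [norm_deltaVec, mul_one]

theorem matEntry_diagOp {X : Type*} [DecidableEq X] (c : X → ℂ) {C : ℝ} (hc : ∀ x, ‖c x‖ ≤ C)
    (x y : X) : matEntry (diagOp c hc) x y = if x = y then c x else 0 := by
  rw [matEntry, diagOp_apply, deltaVec_apply]
  split_ifs <;> simp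

theorem matEntry_diagOp_mul {X : Type*} (c : X → ℂ) {C : ℝ} (hc : ∀ x, ‖c x‖ ≤ C)
    (a : BEll2 X) (x y : X) : matEntry (diagOp c hc * a) x y = c x * matEntry a x y := rfl

theorem matEntry_mul_diagOp {X : Type*} (c : X → ℂ) {C : ℝ} (hc : ∀ x, ‖c x‖ ≤ C)
    (a : BEll2 X) (x y : X) : matEntry (a * diagOp c hc) x y = matEntry a x y * c y := by
  rw [matEntry, mul_apply_eq_comp, diagOp_deltaVec, map_smul, mul_comm]
  rfl

/-! ### The diagonal inclusion and the diagonal expectation -/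

section Roe

variable {X : Type*} [MetricSpace X]

/-- The inclusion of `ℓ_∞(X)` into the uniform Roe algebra as diagonal operators. -/
def roeDiag : EllInf X →L[ℂ] uniformRoeAlgebra X :=
  LinearMap.mkContinuous
    { toFun := fun c => ⟨diagOp c c.norm_apply_le, diagOp_mem_uniformRoeAlgebra _ _⟩
      map_add' := fun c d => by
        classical
        refine Subtype.ext (matEntry_ext fun x y => ?_)
        change _ = matEntry (diagOp c c.norm_apply_le) x y + matEntry (diagOp d d.norm_apply_le) x y
        simp only [matEntry_diagOp, EllInf.add_apply]
        split_ifs <;> simp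
      map_smul' := fun r c => by
        classical
        refine Subtype.ext (matEntry_ext fun x y => ?_)
        change _ = r * matEntry (diagOp c c.norm_apply_le) x y
        simp only [matEntry_diagOp, EllInf.smul_apply]
        split_ifs <;> simp } 1
    (fun c => by
      have : ‖diagOp c c.norm_apply_le‖ ≤ |‖c‖| := LinearMap.mkContinuous_norm_le' _ _ |>.trans
        (by simp)
      rw [abs_norm] at this
      rw [one_mul]
      exact this)

theorem coe_roeDiag (c : EllInf X) : (roeDiag c : BEll2 X) = diagOp c c.norm_apply_le := rfl

theorem roeDiag_mul (c d : EllInf X) : roeDiag (c * d) = roeDiag c * roeDiag d := by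
  classical
  refine Subtype.ext (matEntry_ext fun x y => ?_)
  change _ = matEntry (diagOp c c.norm_apply_le * diagOp d d.norm_apply_le) x y
  rw [coe_roeDiag, matEntry_diagOp_mul, matEntry_diagOp, matEntry_diagOp]
  split_ifs <;> simp

theorem roeDiag_one : roeDiag (1 : EllInf X) = 1 := by
  refine Subtype.ext (ContinuousLinearMap.ext fun f => ?_)
  ext x
  rw [coe_roeDiag, diagOp_apply, EllInf.one_apply, one_mul]
  rfl

theorem roeDiag_ind (S : Set X) : roeDiag (EllInf.ind S) = roeProj S := rfl

theorem roeDiag_star (c : EllInf X) : roeDiag (star c) = star (roeDiag c) := by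
  classical
  refine Subtype.ext (matEntry_ext fun x y => ?_)
  change _ = matEntry (star (diagOp c c.norm_apply_le)) x y
  rw [matEntry_star, coe_roeDiag, matEntry_diagOp, matEntry_diagOp]
  by_cases h : x = y
  · subst h; simp
  · simp [h, Ne.symm h]

/-- The conditional expectation of the uniform Roe algebra onto `ℓ_∞(X)`: the diagonal. -/
def roeExpect : uniformRoeAlgebra X →L[ℂ] EllInf X :=
  LinearMap.mkContinuous
    { toFun := fun a => EllInf.mk (fun x => matEntry (a : BEll2 X) x x)
        (fun x => norm_matEntry_le _ x x)
      map_add' := fun a b => by ext x; rw [EllInf.add_apply]; rfl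
      map_smul' := fun r a => by ext x; rw [RingHom.id_apply, EllInf.smul_apply]; rfl } 1
    (fun a => by
      rw [one_mul]
      exact EllInf.norm_le (norm_nonneg _) fun x => norm_matEntry_le _ x x)

theorem roeExpect_apply (a : uniformRoeAlgebra X) (x : X) :
    roeExpect a x = matEntry (a : BEll2 X) x x := rfl

theorem roeExpect_roeDiag (c : EllInf X) : roeExpect (roeDiag c) = c := by
  classical
  ext x
  rw [roeExpect_apply, coe_roeDiag, matEntry_diagOp, if_pos rfl]

theorem roeExpect_one : roeExpect (1 : uniformRoeAlgebra X) = 1 := by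
  rw [← roeDiag_one, roeExpect_roeDiag]

/-- The diagonal entry of a*a at x is ‖a δ_x‖². -/
theorem roeExpect_star_mul_self_nonneg (a : uniformRoeAlgebra X) (x : X) :
    0 ≤ roeExpect (star a * a) x := by
  rw [roeExpect_apply]
  have : matEntry ((star a * a : uniformRoeAlgebra X) : BEll2 X) x x =
      inner ℂ ((a : BEll2 X) (deltaVec x)) ((a : BEll2 X) (deltaVec x)) := by
    rw [matEntry_eq_inner, ← ContinuousLinearMap.adjoint_inner_right]
    rfl
  rw [this, inner_self_eq_norm_sq_to_K]
  have h := Complex.zero_le_real.2 (sq_nonneg ‖(a : BEll2 X) (deltaVec x)‖)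
  rw [Complex.ofReal_pow] at h
  exact h

/-- A closed property of elements of the uniform Roe algebra holds for all of them if it holds for
the operators of finite propagation. -/
theorem uniformRoeAlgebra_induction {p : uniformRoeAlgebra X → Prop} (hc : IsClosed {a | p a})
    (hp : ∀ a : uniformRoeAlgebra X, HasFinitePropagation (a : BEll2 X) → p a)
    (a : uniformRoeAlgebra X) : p a := by
  have ha : (a : BEll2 X) ∈ closure ((algebraicRoeAlgebra X : StarSubalgebra ℂ (BEll2 X)) :
      Set (BEll2 X)) := by
    rw [← StarSubalgebra.topologicalClosure_coe]
    exact a.2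
  obtain ⟨u, hu, hlim⟩ := mem_closure_iff_seq_limit.1 ha
  refine hc.mem_of_tendsto (f := fun k => (⟨u k, StarSubalgebra.le_topologicalClosure _ (hu k)⟩ :
    uniformRoeAlgebra X)) (b := Filter.atTop) ?_ (Filter.Eventually.of_forall fun k => hp _ (hu k))
  exact tendsto_subtype_rng.2 hlim

end Roe

namespace BranchingTree

variable {n : ℕ}

/-! ### Words -/

/-- The word `u` followed by the word `z`. -/
def append (u : BranchingTree n) (z : List (Fin n)) : BranchingTree n := List.append u z

theorem append_nil (u : BranchingTree n) : u.append [] = u := List.append_nil (as := u)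

theorem append_append (u : BranchingTree n) (z w : List (Fin n)) :
    (u.append z).append w = u.append (z ++ w) := List.append_assoc (u : List (Fin n)) z w

theorem append_singleton (u : BranchingTree n) (k : Fin n) : u.append [k] = u.snoc k := rfl

theorem length_append (u : BranchingTree n) (z : List (Fin n)) :
    (u.append z).length = u.length + z.length := List.length_append (as := u) (bs := z)

theorem length_snoc (u : BranchingTree n) (k : Fin n) : (u.snoc k).length = u.length + 1 :=
  length_append u [k]

theorem length_root : (root n).length = 0 := rfl

theorem append_left_injective (z : List (Fin n)) :
    Function.Injective fun u : BranchingTree n => u.append z :=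
  fun u v h => List.append_cancel_right (as := u) (bs := z) (cs := v) h

theorem append_right_injective (u : BranchingTree n) :
    Function.Injective fun z : List (Fin n) => u.append z :=
  fun _ _ h => List.append_cancel_left (as := u) h

theorem snoc_injective (k : Fin n) : Function.Injective fun u : BranchingTree n => u.snoc k :=
  append_left_injective [k]

theorem snoc_ne_root (u : BranchingTree n) (k : Fin n) : u.snoc k ≠ root n := fun h => by
  have := congrArg length h
  rw [length_snoc, length_root] at this
  omega

theorem eq_root_or_eq_snoc (y : BranchingTree n) : y = root n ∨ ∃ u k, y = snoc u k :=
  List.eq_nil_or_concat' (y : List (Fin n))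

theorem snoc_inj {u v : BranchingTree n} {j k : Fin n} (h : u.snoc j = v.snoc k) :
    u = v ∧ j = k := by
  have := List.append_inj' (s₁ := (u : List (Fin n))) (s₂ := v) (t₁ := [j]) (t₂ := [k]) h rfl
  exact ⟨this.1, by simpa using this.2⟩

theorem root_append_iff {u : BranchingTree n} {w : List (Fin n)} :
    root n = u.append w ↔ u = root n ∧ w = [] := by
  exact eq_comm.trans (List.append_eq_nil_iff (p := (u : List (Fin n))) (q := w))

theorem exists_eq_root_append (y : BranchingTree n) :
    ∃ w : List (Fin n), w.length = y.length ∧ y = (root n).append w := ⟨y, rfl, rfl⟩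

instance : Countable (BranchingTree n) := inferInstanceAs (Countable (List (Fin n)))

/-! ### Distances -/

/-- A walk of length r changes at most the last r letters, so its endpoints share a prefix with both
remainders of length at most r. The prefix u need not be the longest common one. -/
theorem exists_append_of_walk {x y : BranchingTree n} (p : (graph n).Walk x y) :
    ∃ (u : BranchingTree n) (z w : List (Fin n)), x = u.append z ∧ y = u.append w ∧
      z.length ≤ p.length ∧ w.length ≤ p.length := by
  induction p with
  | nil => exact ⟨_, [], [], (append_nil _).symm, (append_nil _).symm, by simp, by simp⟩
  | @cons a b c h p ih =>
    obtain ⟨u, z, w, rfl, rfl, hz, hw⟩ := ih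
    rw [SimpleGraph.Walk.length_cons]
    obtain ⟨k, rfl | hk⟩ := h
    · exact ⟨u, z ++ [k], w, by rw [← append_append]; rfl, rfl, by simpa using hz, by omega⟩
    -- The walk starts by adding a letter. If nothing of z is left to cancel it, the common prefix
    -- retreats to `a` and the letter passes to w; otherwise it is the last letter of z.
    · rcases List.eq_nil_or_concat' z with rfl | ⟨z', j, rfl⟩
      · rw [append_nil] at hk
        subst hk
        refine ⟨a, [], k :: w, (append_nil a).symm, ?_, by simp, by simpa using hw⟩
        rw [← append_singleton, append_append]
        rfl
      · rw [← append_append] at hk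
        obtain ⟨rfl, -⟩ := snoc_inj hk
        refine ⟨u, z', w, rfl, rfl, ?_, by omega⟩
        rw [List.length_append, List.length_singleton] at hz
        omega

theorem exists_append_of_dist_le {x y : BranchingTree n} {r : ℕ} (h : dist x y ≤ r) :
    ∃ (u : BranchingTree n) (z w : List (Fin n)), x = u.append z ∧ y = u.append w ∧
      z.length ≤ r ∧ w.length ≤ r := by
  obtain ⟨p, hp⟩ := (graph_connected n).exists_walk_length_eq_dist x y
  have h' : (graph n).dist x y ≤ r := by exact_mod_cast (show ((graph n).dist x y : ℝ) ≤ r from h)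
  obtain ⟨u, z, w, hx, hy, hz, hw⟩ := exists_append_of_walk p
  exact ⟨u, z, w, hx, hy, by omega, by omega⟩

theorem dist_snoc_le (u : BranchingTree n) (k : Fin n) : dist (u.snoc k) u ≤ 1 := by
  have h : (graph n).Adj (u.snoc k) u := ⟨k, Or.inl rfl⟩
  have := SimpleGraph.dist_eq_one_iff_adj.2 h
  change (((graph n).dist (u.snoc k) u : ℕ) : ℝ) ≤ 1
  rw [this, Nat.cast_one]

theorem height_eq_length (x : BranchingTree n) : height x = x.length := by
  apply le_antisymm
  · have key : ∀ w : List (Fin n), dist ((root n).append w) (root n) ≤ w.length := by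
      intro w
      induction w using List.reverseRecOn with
      | nil => rw [append_nil, dist_self]; simp
      | append_singleton w k ih =>
        rw [← append_append, append_singleton]
        refine (dist_triangle _ ((root n).append w) (root n)).trans ?_
        rw [List.length_append, List.length_singleton, Nat.cast_add, Nat.cast_one, add_comm]
        exact add_le_add ih (dist_snoc_le _ k)
    exact key x
  · obtain ⟨u, z, w, hx, hw, hz, -⟩ := exists_append_of_dist_le
      (show dist x (root n) ≤ ((graph n).dist x (root n) : ℕ) from le_rfl)
    obtain ⟨rfl, rfl⟩ := root_append_iff.1 hw
    have : x.length ≤ (graph n).dist x (root n) := by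
      refine le_trans (le_of_eq ?_) hz
      rw [hx, length_append, length_root, zero_add]
    change (x.length : ℝ) ≤ ((graph n).dist x (root n) : ℕ)
    exact_mod_cast this

theorem height_append (u : BranchingTree n) (z : List (Fin n)) :
    height (u.append z) = height u + z.length := by
  rw [height_eq_length, height_eq_length, length_append, Nat.cast_add]

/-! ### Shifts on bounded families -/

open Classical in
/-- The family `g` transported to the set of words ending in `w`: its value at `u ⌢ w` is `g u`,
and it vanishes elsewhere. -/
def shiftFun (w : List (Fin n)) (g : BranchingTree n → ℂ) (y : BranchingTree n) : ℂ :=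
  if h : ∃ u : BranchingTree n, y = u.append w then g h.choose else 0

theorem shiftFun_append (w : List (Fin n)) (g : BranchingTree n → ℂ) (u : BranchingTree n) :
    shiftFun w g (u.append w) = g u := by
  have h : ∃ v : BranchingTree n, u.append w = v.append w := ⟨u, rfl⟩
  rw [shiftFun, dif_pos h]
  exact congrArg g (append_left_injective w h.choose_spec.symm)

theorem shiftFun_of_not (w : List (Fin n)) (g : BranchingTree n → ℂ) {y : BranchingTree n}
    (h : ∀ u : BranchingTree n, y ≠ u.append w) : shiftFun w g y = 0 :=
  dif_neg (by simpa using h)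

theorem norm_shiftFun_le (w : List (Fin n)) (g : EllInf (BranchingTree n)) (y : BranchingTree n) :
    ‖shiftFun w g y‖ ≤ ‖g‖ := by
  by_cases h : ∃ u : BranchingTree n, y = u.append w
  · obtain ⟨u, rfl⟩ := h
    rw [shiftFun_append]
    exact g.norm_apply_le u
  · rw [shiftFun_of_not w g (by simpa using h), norm_zero]
    exact norm_nonneg _

/-- `shiftFun w` as an operator on `ℓ_∞(T_n)`. -/
def shift (w : List (Fin n)) : EllInf (BranchingTree n) →L[ℂ] EllInf (BranchingTree n) :=
  LinearMap.mkContinuous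
    { toFun := fun g => EllInf.mk (shiftFun w g) (norm_shiftFun_le w g)
      map_add' := fun f g => by
        ext y
        rw [EllInf.add_apply, EllInf.mk_apply, EllInf.mk_apply, EllInf.mk_apply]
        by_cases h : ∃ u : BranchingTree n, y = u.append w
        · obtain ⟨u, rfl⟩ := h
          rw [shiftFun_append, shiftFun_append, shiftFun_append, EllInf.add_apply]
        · have h' : ∀ u : BranchingTree n, y ≠ u.append w := by simpa using h
          rw [shiftFun_of_not w _ h', shiftFun_of_not w _ h', shiftFun_of_not w _ h', add_zero]
      map_smul' := fun c g => by
        ext y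
        rw [RingHom.id_apply, EllInf.smul_apply, EllInf.mk_apply, EllInf.mk_apply]
        by_cases h : ∃ u : BranchingTree n, y = u.append w
        · obtain ⟨u, rfl⟩ := h
          simp [shiftFun_append]
        · have h' : ∀ u : BranchingTree n, y ≠ u.append w := by simpa using h
          simp [shiftFun_of_not w _ h'] } 1
    (fun g => by
      rw [one_mul]
      exact EllInf.norm_le (norm_nonneg _) (norm_shiftFun_le w g))

theorem shift_append (w : List (Fin n)) (g : EllInf (BranchingTree n)) (u : BranchingTree n) :
    shift w g (u.append w) = g u := shiftFun_append w g u

theorem shift_of_not (w : List (Fin n)) (g : EllInf (BranchingTree n)) {y : BranchingTree n}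
    (h : ∀ u : BranchingTree n, y ≠ u.append w) : shift w g y = 0 := shiftFun_of_not w g h

theorem shift_nil (g : EllInf (BranchingTree n)) : shift [] g = g := by
  ext u
  have := shift_append [] g u
  rwa [append_nil] at this

theorem shift_singleton_snoc (k : Fin n) (g : EllInf (BranchingTree n)) (u : BranchingTree n) :
    shift [k] g (u.snoc k) = g u := shift_append [k] g u

theorem shift_singleton_snoc_of_ne {j k : Fin n} (h : j ≠ k) (g : EllInf (BranchingTree n))
    (u : BranchingTree n) : shift [k] g (u.snoc j) = 0 :=
  shift_of_not [k] g fun _ hv => h (snoc_inj hv).2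

theorem shift_singleton_root (k : Fin n) (g : EllInf (BranchingTree n)) :
    shift [k] g (root n) = 0 :=
  shift_of_not [k] g fun v hv => snoc_ne_root v k hv.symm

theorem shift_concat (w : List (Fin n)) (k : Fin n) (g : EllInf (BranchingTree n)) :
    shift (w ++ [k]) g = shift [k] (shift w g) := by
  ext y
  by_cases h : ∃ v : BranchingTree n, y = v.append [k]
  · obtain ⟨v, rfl⟩ := h
    rw [shift_append]
    by_cases h' : ∃ u : BranchingTree n, v = u.append w
    · obtain ⟨u, rfl⟩ := h'
      rw [append_append, shift_append, shift_append]
    · rw [shift_of_not w g (by simpa using h'), shift_of_not]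
      intro u hu
      rw [← append_append] at hu
      exact h' ⟨u, append_left_injective [k] hu⟩
  · rw [shift_of_not [k] _ (by simpa using h), shift_of_not]
    intro u hu
    rw [← append_append] at hu
    exact h ⟨_, hu⟩

/-- Every point mass is a shift of another, so a conformal functional is known on points once it is
known at the root. -/
theorem ind_singleton_append (u : BranchingTree n) (w : List (Fin n)) :
    EllInf.ind {u.append w} = shift w (EllInf.ind {u}) := by
  ext y
  by_cases h : ∃ v : BranchingTree n, y = v.append w
  · obtain ⟨v, rfl⟩ := h
    rw [shift_append]
    by_cases huv : v = u
    · subst huv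
      rw [EllInf.ind_singleton_self, EllInf.ind_singleton_self]
    · rw [EllInf.ind_singleton_of_ne huv, EllInf.ind_singleton_of_ne]
      exact fun h => huv (append_left_injective w h)
  · rw [shift_of_not w _ (by simpa using h), EllInf.ind_singleton_of_ne]
    rintro rfl
    exact h ⟨u, rfl⟩

/-- The unit is the sum of the point mass at the root and the indicator functions of the sets of
words with a given last letter. -/
theorem one_eq_ind_root_add_sum :
    (1 : EllInf (BranchingTree n)) = EllInf.ind {root n} + ∑ k : Fin n, shift [k] 1 := by
  ext y
  rw [EllInf.add_apply, EllInf.sum_apply, EllInf.one_apply]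
  rcases eq_root_or_eq_snoc y with rfl | ⟨u, j, rfl⟩
  · rw [EllInf.ind_singleton_self, Finset.sum_eq_zero fun k _ => shift_singleton_root k 1, add_zero]
  · rw [EllInf.ind_singleton_of_ne (snoc_ne_root u j), zero_add,
      Finset.sum_eq_single j (fun k _ hk => shift_singleton_snoc_of_ne hk.symm 1 u) (by simp),
      shift_singleton_snoc, EllInf.one_apply]

/-! ### The isometries `δ_x ↦ δ_{x ⌢ k}` -/

theorem orthonormal_deltaVec {X : Type*} : Orthonormal ℂ (deltaVec : X → Ell2 X) := by
  classical
  rw [orthonormal_iff_ite]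
  intro x y
  rw [inner_deltaVec, deltaVec_apply]

/-- The isometry `δ_x ↦ δ_{x ⌢ k}`. -/
def snocIsometry (k : Fin n) : BEll2 (BranchingTree n) :=
  ((orthonormal_deltaVec (X := BranchingTree n)).comp (fun u => u.snoc k)
    (snoc_injective k)).orthogonalFamily.linearIsometry.toContinuousLinearMap

theorem snocIsometry_deltaVec (k : Fin n) (x : BranchingTree n) :
    snocIsometry k (deltaVec x) = deltaVec (x.snoc k) := by
  classical
  have := ((orthonormal_deltaVec (X := BranchingTree n)).comp (fun u => u.snoc k)
    (snoc_injective k)).orthogonalFamily.linearIsometry_apply_single (i := x) (1 : ℂ)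
  rw [LinearIsometry.toSpanSingleton_apply, one_smul] at this
  exact this

theorem matEntry_snocIsometry [DecidableEq (BranchingTree n)] (k : Fin n) (x y : BranchingTree n) :
    matEntry (snocIsometry k) x y = if x = y.snoc k then 1 else 0 := by
  rw [matEntry, snocIsometry_deltaVec, deltaVec_apply]

theorem snocIsometry_mem (k : Fin n) : snocIsometry k ∈ algebraicRoeAlgebra (BranchingTree n) := by
  classical
  refine ⟨1, fun x y h => ?_⟩
  rw [matEntry_snocIsometry] at h
  have : x = y.snoc k := by_contra fun h' => h (if_neg h')
  rw [this]
  exact dist_snoc_le y k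

/-- The isometry `δ_x ↦ δ_{x ⌢ k}` as an element of the uniform Roe algebra. -/
def snocRoe (k : Fin n) : uniformRoeAlgebra (BranchingTree n) :=
  ⟨snocIsometry k, StarSubalgebra.le_topologicalClosure _ (snocIsometry_mem k)⟩

theorem star_snocRoe_mul_self (k : Fin n) : star (snocRoe k) * snocRoe k = 1 := by
  classical
  refine Subtype.ext (matEntry_ext fun x y => ?_)
  change matEntry (star (snocIsometry k) * snocIsometry k) x y = matEntry (1 : BEll2 _) x y
  rw [matEntry_eq_inner, mul_apply_eq_comp, ContinuousLinearMap.star_eq_adjoint,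
    ContinuousLinearMap.adjoint_inner_right, snocIsometry_deltaVec, snocIsometry_deltaVec,
    inner_deltaVec, deltaVec_apply]
  change _ = (deltaVec y : Ell2 _) x
  rw [deltaVec_apply]
  simp only [(snoc_injective k).eq_iff]

theorem matEntry_snocIsometry_mul (k : Fin n) (a : BEll2 (BranchingTree n))
    (x y : BranchingTree n) : matEntry (snocIsometry k * a) (x.snoc k) y = matEntry a x y := by
  classical
  refine (matEntry_mul (snocIsometry k) a (x.snoc k) y).unique ?_
  convert hasSum_single (f := fun z => matEntry a z y * matEntry (snocIsometry k) (x.snoc k) z) x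
    (fun z hz => ?_) using 1
  · rw [matEntry_snocIsometry, if_pos rfl, mul_one]
  · rw [matEntry_snocIsometry, if_neg fun h => hz (snoc_inj h).1.symm, mul_zero]

theorem matEntry_snocIsometry_mul_of_ne (k : Fin n) (a : BEll2 (BranchingTree n))
    {x y : BranchingTree n} (h : ∀ u, x ≠ snoc u k) : matEntry (snocIsometry k * a) x y = 0 := by
  classical
  refine (matEntry_mul (snocIsometry k) a x y).unique ?_
  simp [matEntry_snocIsometry, h]

theorem matEntry_mul_star_snocIsometry (k : Fin n) (a : BEll2 (BranchingTree n))
    (x y : BranchingTree n) :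
    matEntry (a * star (snocIsometry k)) x (y.snoc k) = matEntry a x y := by
  rw [← star_star (a * star (snocIsometry k)), matEntry_star, star_mul, star_star,
    matEntry_snocIsometry_mul, matEntry_star, star_star]

theorem matEntry_mul_star_snocIsometry_of_ne (k : Fin n) (a : BEll2 (BranchingTree n))
    {x y : BranchingTree n} (h : ∀ u, y ≠ snoc u k) :
    matEntry (a * star (snocIsometry k)) x y = 0 := by
  rw [← star_star (a * star (snocIsometry k)), matEntry_star, star_mul, star_star,
    matEntry_snocIsometry_mul_of_ne k _ h, star_zero]

/-- Conjugation by the isometry implements the shift of families; this is how the KMS condition gets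
to see `shift`. -/
theorem snocRoe_mul_roeDiag_mul_star (k : Fin n) (f : EllInf (BranchingTree n)) :
    snocRoe k * roeDiag f * star (snocRoe k) = roeDiag (shift [k] f) := by
  classical
  refine Subtype.ext (matEntry_ext fun x y => ?_)
  change matEntry (snocIsometry k * diagOp f f.norm_apply_le * star (snocIsometry k)) x y = _
  rw [coe_roeDiag, matEntry_diagOp]
  by_cases hy : ∃ v, y = snoc v k
  · obtain ⟨v, rfl⟩ := hy
    rw [matEntry_mul_star_snocIsometry]
    by_cases hx : ∃ u, x = snoc u k
    · obtain ⟨u, rfl⟩ := hx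
      rw [matEntry_snocIsometry_mul, matEntry_diagOp, shift_singleton_snoc]
      simp only [(snoc_injective k).eq_iff]
    · push Not at hx
      rw [matEntry_snocIsometry_mul_of_ne k _ hx, if_neg (hx v)]
  · push Not at hy
    rw [matEntry_mul_star_snocIsometry_of_ne k _ hy]
    split_ifs with h
    · rw [h, shift_of_not [k] f hy]
    · rfl

end BranchingTree

/-! ### Analytic elements of the flow and the centralizer of a KMS state -/

section Flow

variable {X : Type*} [MetricSpace X]

/-- The matrix entries as functionals on the uniform Roe algebra. -/
def roeEntry (x y : X) : uniformRoeAlgebra X →L[ℂ] ℂ :=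
  LinearMap.mkContinuous
    { toFun := fun a => matEntry (a : BEll2 X) x y
      map_add' := fun _ _ => rfl
      map_smul' := fun _ _ => rfl } 1
    (fun a => by rw [one_mul]; exact norm_matEntry_le _ x y)

theorem roeEntry_apply (x y : X) (a : uniformRoeAlgebra X) :
    roeEntry x y a = matEntry (a : BEll2 X) x y := rfl

theorem roeEntry_ext {a b : uniformRoeAlgebra X} (h : ∀ x y, roeEntry x y a = roeEntry x y b) :
    a = b := Subtype.ext (matEntry_ext h)

theorem roeEntry_roeFlow (h : X → ℝ) (t : ℝ) (a : uniformRoeAlgebra X) (x y : X) :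
    roeEntry x y (roeFlow h t a) =
      Complex.exp (Complex.I * t * (h x - h y : ℝ)) * roeEntry x y a := by
  have := matEntry_diagOp_mul_mul _ _ (norm_exp_I_mul_le h t) (norm_exp_I_mul_le h (-t))
    (a : BEll2 X) x y
  refine this.trans ?_
  rw [mul_right_comm, ← Complex.exp_add, roeEntry_apply]
  congr 2
  push_cast
  ring

/-- An operator all of whose entries change the height by c is an eigenvector of the flow with
character e^{itc}, which extends to all complex times. -/
theorem isEntireExtension_of_homogeneous {h : X → ℝ} {b : uniformRoeAlgebra X} {c : ℝ}
    (hb : ∀ x y, roeEntry x y b ≠ 0 → h x - h y = c) :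
    IsEntireExtension (roeFlow h) b (fun z => Complex.exp (Complex.I * z * c) • b) := by
  refine ⟨?_, fun t => roeEntry_ext fun x y => ?_⟩
  · fun_prop
  · rw [roeEntry_roeFlow, map_smul, smul_eq_mul]
    by_cases h0 : roeEntry x y b = 0
    · simp [h0]
    · rw [hb x y h0]

/-- Identity theorem, entry by entry: both sides are entire and agree on the real axis, where 0 is
an accumulation point. -/
theorem IsEntireExtension.roeEntry_eq {h : X → ℝ} {b : uniformRoeAlgebra X}
    {F : ℂ → uniformRoeAlgebra X} (hF : IsEntireExtension (roeFlow h) b F) (x y : X) (z : ℂ) :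
    roeEntry x y (F z) = Complex.exp (Complex.I * z * (h x - h y : ℝ)) * roeEntry x y b := by
  have h1 : AnalyticOnNhd ℂ (fun z => roeEntry x y (F z)) Set.univ :=
    (((roeEntry x y).differentiable.comp hF.1).differentiableOn).analyticOnNhd isOpen_univ
  have h2 : AnalyticOnNhd ℂ
      (fun z => Complex.exp (Complex.I * z * (h x - h y : ℝ)) * roeEntry x y b) Set.univ := by
    refine DifferentiableOn.analyticOnNhd (Differentiable.differentiableOn ?_) isOpen_univ
    fun_prop
  have ht : Filter.Tendsto (fun t : ℝ => (t : ℂ)) (nhdsWithin 0 {0}ᶜ) (nhdsWithin 0 {0}ᶜ) := by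
    refine tendsto_nhdsWithin_iff.2 ⟨?_, ?_⟩
    · exact (Complex.continuous_ofReal.tendsto' 0 0 Complex.ofReal_zero).mono_left
        nhdsWithin_le_nhds
    · filter_upwards [self_mem_nhdsWithin] with t ht
      simpa using ht
  refine congrFun (h1.eq_of_frequently_eq h2 (z₀ := 0) ?_) z
  refine ht.frequently (Filter.Frequently.of_forall fun t => ?_)
  rw [hF.2 t, roeEntry_roeFlow]

/-- Diagonal operators have degree 0, so σ_{iβ} fixes them and the KMS condition becomes a trace
property. -/
theorem IsKMSState.apply_roeDiag_mul {h : X → ℝ} {β : ℝ} {φ : uniformRoeAlgebra X →L[ℂ] ℂ}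
    (hφ : IsKMSState (roeFlow h) β φ) (f : EllInf X) (a : uniformRoeAlgebra X) :
    φ (roeDiag f * a) = φ (a * roeDiag f) := by
  classical
  have := hφ.2 a (roeDiag f) _ (isEntireExtension_of_homogeneous (c := 0) fun x y hxy => by
    rw [roeEntry_apply, coe_roeDiag, matEntry_diagOp] at hxy
    have : x = y := by_contra fun h' => hxy (if_neg h')
    rw [this, sub_self])
  rw [← this, Complex.ofReal_zero, mul_zero, Complex.exp_zero, one_smul]

/-- A nonnegative family is g*g with g its square root. -/
theorem IsState.isPositive_comp_roeDiag {φ : uniformRoeAlgebra X →L[ℂ] ℂ} (hφ : IsState φ) :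
    EllInf.IsPositive (φ.comp roeDiag) := by
  intro f hf
  have hb : ∀ x, ‖((√‖f x‖ : ℝ) : ℂ)‖ ≤ √‖f‖ := fun x => by
    rw [Complex.norm_real, Real.norm_of_nonneg (Real.sqrt_nonneg _)]
    exact Real.sqrt_le_sqrt (f.norm_apply_le x)
  have hs : f = star (EllInf.mk (fun x => ((√‖f x‖ : ℝ) : ℂ)) hb) *
      EllInf.mk (fun x => ((√‖f x‖ : ℝ) : ℂ)) hb := by
    ext x
    rw [EllInf.mul_apply]
    change f x = star ((√‖f x‖ : ℝ) : ℂ) * ((√‖f x‖ : ℝ) : ℂ)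
    rw [Complex.star_def, Complex.conj_ofReal, ← Complex.ofReal_mul,
      Real.mul_self_sqrt (norm_nonneg _)]
    exact (Complex.norm_of_nonneg' (hf x)).symm
  rw [ContinuousLinearMap.comp_apply, hs, roeDiag_mul, roeDiag_star]
  exact hφ.1 _

/-- Writing χ_S = χ_S² and moving one factor to the other side replaces χ_S a by χ_S a χ_S, which is
diagonal by hypothesis. -/
theorem IsKMSState.apply_roeDiag_ind_mul {h : X → ℝ} {β : ℝ} {φ : uniformRoeAlgebra X →L[ℂ] ℂ}
    (hφ : IsKMSState (roeFlow h) β φ) {S : Set X} (a : uniformRoeAlgebra X)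
    (hS : ∀ x ∈ S, ∀ y ∈ S, roeEntry x y a ≠ 0 → x = y) :
    φ (roeDiag (EllInf.ind S) * a) = φ (roeDiag (EllInf.ind S * roeExpect a)) := by
  classical
  have hi : EllInf.ind S * EllInf.ind S = EllInf.ind S := by
    ext x
    rw [EllInf.mul_apply]
    by_cases hx : x ∈ S
    · rw [EllInf.ind_of_mem hx, one_mul]
    · rw [EllInf.ind_of_notMem hx, zero_mul]
  conv_lhs => rw [← hi, roeDiag_mul, mul_assoc, hφ.apply_roeDiag_mul]
  congr 1
  refine Subtype.ext (matEntry_ext fun x y => ?_)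
  change matEntry (diagOp _ (EllInf.norm_apply_le _) * (a : BEll2 X) *
    diagOp _ (EllInf.norm_apply_le _)) x y = _
  rw [matEntry_diagOp_mul_mul, coe_roeDiag, matEntry_diagOp, EllInf.mul_apply, roeExpect_apply]
  by_cases hx : x ∈ S
  swap
  · rw [EllInf.ind_of_notMem hx]; simp
  by_cases hy : y ∈ S
  swap
  · rw [EllInf.ind_of_notMem hy, mul_zero, if_neg]
    rintro rfl
    exact hy hx
  rw [EllInf.ind_of_mem hx, EllInf.ind_of_mem hy, one_mul, mul_one, one_mul]
  split_ifs with hxy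
  · rw [hxy]
  · by_contra h0
    exact hxy (hS x hx y hy h0)

/-- If the matrix entries of `a` between different points of the same colour vanish for some
finite colouring, then KMS states do not see the off-diagonal part of `a`. -/
theorem IsKMSState.apply_eq_of_coloring {h : X → ℝ} {β : ℝ} {φ : uniformRoeAlgebra X →L[ℂ] ℂ}
    (hφ : IsKMSState (roeFlow h) β φ) {ι : Type*} [Finite ι] (col : X → ι)
    (a : uniformRoeAlgebra X)
    (hcol : ∀ x y, roeEntry x y a ≠ 0 → col x = col y → x = y) :
    φ a = φ (roeDiag (roeExpect a)) := by
  classical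
  have := Fintype.ofFinite ι
  -- The colour classes partition X, and the preceding lemma applies to each of them.
  have h1 : (1 : EllInf X) = ∑ i, EllInf.ind (col ⁻¹' {i}) := by
    ext x
    rw [EllInf.one_apply, EllInf.sum_apply, Finset.sum_eq_single (col x),
      EllInf.ind_of_mem (S := col ⁻¹' {col x}) rfl]
    · intro i _ hi
      exact EllInf.ind_of_notMem fun h' => hi h'.symm
    · simp
  have h2 : roeExpect a = ∑ i, EllInf.ind (col ⁻¹' {i}) * roeExpect a := by
    rw [← Finset.sum_mul, ← h1, one_mul]
  let ψ : EllInf X →+ ℂ :=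
    { toFun := fun f => φ (roeDiag f * a)
      map_zero' := by rw [map_zero, zero_mul, map_zero]
      map_add' := fun f g => by rw [map_add, add_mul, map_add] }
  calc φ a = ψ 1 := congrArg φ (by rw [roeDiag_one, one_mul])
    _ = ∑ i, φ (roeDiag (EllInf.ind (col ⁻¹' {i})) * a) :=
      (congrArg ψ h1).trans (map_sum ψ _ _)
    _ = ∑ i, (φ.comp roeDiag) (EllInf.ind (col ⁻¹' {i}) * roeExpect a) :=
      Finset.sum_congr rfl fun i _ => hφ.apply_roeDiag_ind_mul a fun x hx y hy h0 =>
        hcol x y h0 (Eq.trans hx (Eq.symm hy))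
    _ = (φ.comp roeDiag) (roeExpect a) :=
      (map_sum (φ.comp roeDiag) _ _).symm.trans (congrArg _ h2.symm)

end Flow

/-! ### KMS states as conformal functionals on the diagonal -/

namespace BranchingTree

variable {n : ℕ}

/-- The length of a word modulo `r + 1` together with its last `r` letters. -/
def color (r : ℕ) (x : BranchingTree n) : Fin (r + 1) × {l : List (Fin n) // l.length ≤ r} :=
  (⟨x.length % (r + 1), Nat.mod_lt _ r.succ_pos⟩,
    ⟨(List.reverse x).take r, List.length_take_le _ _⟩)

theorem eq_of_take_reverse_append_eq {α : Type*} (u : List α) {z w : List α} {r : ℕ}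
    (hlen : z.length = w.length) (hz : z.length ≤ r)
    (h : (u ++ z).reverse.take r = (u ++ w).reverse.take r) : z = w := by
  have h3 := congrArg (List.take z.length) h
  rw [List.take_take, List.take_take, min_eq_left hz, List.reverse_append, List.reverse_append,
    List.take_left' (by simp), List.take_left' (by simp [hlen])] at h3
  exact List.reverse_injective h3

/-- Words at distance at most r differ only in tails z, w of length at most r after a common prefix.
Equal length modulo r + 1 forces |z| = |w|, and then the last r letters determine the tails. -/
theorem eq_of_color_eq {r : ℕ} {x y : BranchingTree n} (hd : dist x y ≤ r)
    (hc : color r x = color r y) : x = y := by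
  obtain ⟨u, z, w, rfl, rfl, hz, hw⟩ := exists_append_of_dist_le hd
  rw [color, color, Prod.mk.injEq, Fin.mk.injEq, Subtype.mk.injEq, length_append,
    length_append] at hc
  have hlen : z.length = w.length := by
    have : z.length ≡ w.length [MOD (r + 1)] := Nat.ModEq.add_left_cancel' u.length hc.1
    exact Nat.ModEq.eq_of_lt_of_lt this (by omega) (by omega)
  rw [eq_of_take_reverse_append_eq (u : List (Fin n)) hlen hz hc.2]

/-- A KMS state is determined by its restriction to the diagonal. -/
theorem apply_eq_apply_roeDiag_roeExpect {β : ℝ}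
    {φ : uniformRoeAlgebra (BranchingTree n) →L[ℂ] ℂ} (hφ : φ ∈ kmsStates n β)
    (a : uniformRoeAlgebra (BranchingTree n)) : φ a = φ (roeDiag (roeExpect a)) := by
  induction a using uniformRoeAlgebra_induction with
  | hc =>
    exact isClosed_eq φ.continuous (φ.comp
      ((roeDiag (X := BranchingTree n)).comp (roeExpect (X := BranchingTree n)))).continuous
  | hp a ha =>
    obtain ⟨r, hr⟩ := ha
    have : Finite {l : List (Fin n) // l.length ≤ ⌈r⌉₊} :=
      (List.finite_length_le (Fin n) ⌈r⌉₊).to_subtype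
    refine IsKMSState.apply_eq_of_coloring hφ (color ⌈r⌉₊) a fun x y hxy hc => ?_
    exact eq_of_color_eq ((hr x y hxy).trans (Nat.le_ceil r)) hc

/-- The functionals on `ℓ_∞(T_n)` which correspond to the KMS states: the states for which the
letter `k` added at the end of all words scales the measure by `e^{-β}`. -/
structure IsConformal (β : ℝ) (m : EllInf (BranchingTree n) →L[ℂ] ℂ) : Prop where
  isPositive : EllInf.IsPositive m
  map_one : m 1 = 1
  map_shift_singleton : ∀ (k : Fin n) (g : EllInf (BranchingTree n)),
    m (shift [k] g) = Real.exp (-β) * m g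

/-- With V the isometry appending k, apply the KMS condition to a = V* and b = V g. Since b has
degree 1, σ_{iβ}(b) = e^{-β} b; moreover V*V = 1, while V g V* is the shifted family. -/
theorem isConformal_of_mem_kmsStates {β : ℝ} {φ : uniformRoeAlgebra (BranchingTree n) →L[ℂ] ℂ}
    (hφ : φ ∈ kmsStates n β) : IsConformal β (φ.comp roeDiag) where
  isPositive := hφ.1.isPositive_comp_roeDiag
  map_one := by rw [ContinuousLinearMap.comp_apply, roeDiag_one, hφ.1.2]
  map_shift_singleton k g := by
    classical
    have := hφ.2 (star (snocRoe k)) (snocRoe k * roeDiag g) _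
      (isEntireExtension_of_homogeneous (c := 1) fun x y hxy => by
        have h : roeEntry x y (snocRoe k * roeDiag g) = matEntry (snocIsometry k) x y * g y :=
          matEntry_mul_diagOp g g.norm_apply_le _ x y
        rw [h, matEntry_snocIsometry] at hxy
        have : x = y.snoc k := by_contra fun h' => hxy (by rw [if_neg h', zero_mul])
        rw [this, ← append_singleton, height_append]
        simp)
    rw [snocRoe_mul_roeDiag_mul_star, mul_smul_comm, ← mul_assoc (star (snocRoe k)), star_snocRoe_mul_self, one_mul,
      map_smul, smul_eq_mul] at this
    rw [ContinuousLinearMap.comp_apply, ContinuousLinearMap.comp_apply, ← this]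
    congr 1
    rw [Complex.ofReal_exp, Complex.ofReal_one, mul_one, ← mul_assoc, Complex.I_mul_I]
    congr 1
    push_cast
    ring

theorem IsConformal.map_shift {β : ℝ} {m : EllInf (BranchingTree n) →L[ℂ] ℂ}
    (hm : IsConformal β m) (w : List (Fin n)) (g : EllInf (BranchingTree n)) :
    m (shift w g) = Real.exp (-β * w.length) * m g := by
  induction w using List.reverseRecOn with
  | nil => simp [shift_nil]
  | append_singleton w k ih =>
    rw [shift_concat, hm.map_shift_singleton, ih, ← mul_assoc, ← Complex.ofReal_mul,
      ← Real.exp_add]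
    congr 3
    rw [List.length_append, List.length_singleton]
    push_cast
    ring

/-! ### Mass transport along a kernel of finite propagation -/

section Kernel

variable (c : BranchingTree n → BranchingTree n → ℂ) {C : ℝ} (hc : ∀ x y, ‖c x y‖ ≤ C)
  (κ : BranchingTree n → BranchingTree n → List (Fin n) × List (Fin n))

include hc in
theorem norm_kernelPiece_le (p : List (Fin n) × List (Fin n)) (u : BranchingTree n) :
    ‖(if κ (u.append p.1) (u.append p.2) = p then c (u.append p.1) (u.append p.2) else 0)‖ ≤ C := by
  split_ifs
  · exact hc _ _
  · rw [norm_zero]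
    exact (norm_nonneg _).trans (hc u u)

/-- The part of the kernel `c` on the pairs `(u ⌢ z, u ⌢ w)` to which `κ` assigns `(z, w)`. -/
def kernelPiece (p : List (Fin n) × List (Fin n)) : EllInf (BranchingTree n) :=
  EllInf.mk (fun u => if κ (u.append p.1) (u.append p.2) = p then
    c (u.append p.1) (u.append p.2) else 0) (norm_kernelPiece_le c hc κ p)

variable {P : Finset (List (Fin n) × List (Fin n))}
  (hκ : ∀ x y, c x y ≠ 0 → κ x y ∈ P ∧ ∃ u : BranchingTree n,
    x = u.append (κ x y).1 ∧ y = u.append (κ x y).2)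

include hκ

/-- For fixed y = u⌢w, a pair (z, w) accounts for the single term x = u⌢z. Summing over x therefore
places each piece at the words u⌢w, that is, shifts it by w. -/
theorem hasSum_kernel_left (y : BranchingTree n) :
    HasSum (fun x => c x y) ((∑ p ∈ P, shift p.2 (kernelPiece c hc κ p)) y) := by
  rw [EllInf.sum_apply]
  have h1 : (fun x => c x y) = fun x => ∑ p ∈ P, if κ x y = p then c x y else 0 := by
    funext x
    rw [Finset.sum_ite_eq]
    by_cases h : c x y = 0
    · simp [h]
    · rw [if_pos (hκ x y h).1]
  rw [h1]
  refine hasSum_sum fun p _ => ?_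
  by_cases h : ∃ u : BranchingTree n, y = u.append p.2
  · obtain ⟨u, rfl⟩ := h
    rw [shift_append]
    refine hasSum_single (u.append p.1) fun x hx => ?_
    split_ifs with hp
    · by_contra h0
      obtain ⟨v, hv1, hv2⟩ := (hκ x _ h0).2
      rw [hp] at hv1 hv2
      rw [append_left_injective p.2 hv2] at hx
      exact hx hv1
    · rfl
  · rw [shift_of_not _ _ (by simpa using h)]
    convert hasSum_zero using 2 with x
    split_ifs with hp
    · by_contra h0
      obtain ⟨v, -, hv2⟩ := (hκ x _ h0).2
      rw [hp] at hv2
      exact h ⟨v, hv2⟩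
    · rfl

/-- The mirror image: summing over y shifts the same pieces by z. The weight is constant on a piece,
since the height difference there is |w| - |z|. -/
theorem hasSum_kernel_right (wt : ℝ → ℂ) (x : BranchingTree n) :
    HasSum (fun y => wt (height y - height x) * c x y)
      ((∑ p ∈ P, wt (p.2.length - p.1.length) • shift p.1 (kernelPiece c hc κ p)) x) := by
  rw [EllInf.sum_apply]
  have h1 : (fun y => wt (height y - height x) * c x y) =
      fun y => ∑ p ∈ P, wt (p.2.length - p.1.length) * if κ x y = p then c x y else 0 := by
    funext y
    by_cases h : c x y = 0
    · simp [h]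
    · obtain ⟨hP, u, hx, hy⟩ := hκ x y h
      rw [Finset.sum_eq_single (κ x y), if_pos rfl]
      · congr 2
        have hx' := congrArg height hx
        have hy' := congrArg height hy
        rw [height_append] at hx' hy'
        rw [hx', hy']
        ring
      · intro p _ hp
        rw [if_neg hp.symm, mul_zero]
      · exact fun h' => absurd hP h'
  rw [h1]
  refine hasSum_sum fun p _ => ?_
  rw [EllInf.smul_apply]
  refine HasSum.mul_left _ ?_
  by_cases h : ∃ u : BranchingTree n, x = u.append p.1
  · obtain ⟨u, rfl⟩ := h
    rw [shift_append]
    refine hasSum_single (u.append p.2) fun y hy => ?_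
    split_ifs with hp
    · by_contra h0
      obtain ⟨v, hv1, hv2⟩ := (hκ _ y h0).2
      rw [hp] at hv1 hv2
      rw [append_left_injective p.1 hv1] at hy
      exact hy hv2
    · rfl
  · rw [shift_of_not _ _ (by simpa using h)]
    convert hasSum_zero using 2 with y
    split_ifs with hp
    · by_contra h0
      obtain ⟨v, hv1, -⟩ := (hκ _ y h0).2
      rw [hp] at hv1
      exact h ⟨v, hv1⟩
    · rfl

end Kernel

/-- A pair of words has several common prefixes; fixing one choice ensures that each matrix entry is
counted once. -/
theorem exists_kernel_choice {a : BEll2 (BranchingTree n)} (ha : HasFinitePropagation a) :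
    ∃ (κ : BranchingTree n → BranchingTree n → List (Fin n) × List (Fin n))
      (P : Finset (List (Fin n) × List (Fin n))), ∀ x y, matEntry a x y ≠ 0 →
        κ x y ∈ P ∧ ∃ u : BranchingTree n, x = u.append (κ x y).1 ∧ y = u.append (κ x y).2 := by
  classical
  obtain ⟨r, hr⟩ := ha
  have hfin := List.finite_length_le (Fin n) ⌈r⌉₊
  have : ∀ x y, ∃ p : List (Fin n) × List (Fin n), matEntry a x y ≠ 0 →
      p ∈ hfin.toFinset ×ˢ hfin.toFinset ∧
        ∃ u : BranchingTree n, x = u.append p.1 ∧ y = u.append p.2 := by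
    intro x y
    by_cases h : matEntry a x y = 0
    · exact ⟨([], []), fun h' => absurd h h'⟩
    · obtain ⟨u, z, w, hx, hy, hz, hw⟩ :=
        exists_append_of_dist_le ((hr x y h).trans (Nat.le_ceil r))
      exact ⟨(z, w), fun _ => ⟨by simp [hz, hw], u, hx, hy⟩⟩
  choose κ hκ using this
  exact ⟨κ, _, hκ⟩

/-- With c(x, y) = a_{x,y} b_{y,x}, the diagonals of b a and of a σ_{iβ}(b) are the column sums and
the weighted row sums of c. Conformality makes their totals agree. -/
theorem IsConformal.comp_roeExpect_mem_kmsStates {β : ℝ}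
    {m : EllInf (BranchingTree n) →L[ℂ] ℂ} (hm : IsConformal β m) :
    m.comp roeExpect ∈ kmsStates n β := by
  refine ⟨⟨fun a => hm.isPositive _ (roeExpect_star_mul_self_nonneg a), ?_⟩, fun a b F hF => ?_⟩
  · rw [ContinuousLinearMap.comp_apply, roeExpect_one, hm.map_one]
  -- Only a is approximated by operators of finite propagation: both sides are continuous in a,
  -- while b and its extension F stay fixed.
  induction a using uniformRoeAlgebra_induction with
  | hc =>
    exact isClosed_eq ((m.comp roeExpect).continuous.comp (continuous_id.mul continuous_const))
      ((m.comp roeExpect).continuous.comp (continuous_const.mul continuous_id))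
  | hp a ha =>
    obtain ⟨κ, P, hκ⟩ := exists_kernel_choice ha
    have hc : ∀ x y, ‖matEntry (a : BEll2 (BranchingTree n)) x y * roeEntry y x b‖ ≤
        ‖(a : BEll2 (BranchingTree n))‖ * ‖(b : BEll2 (BranchingTree n))‖ := fun x y => by
      rw [norm_mul]
      exact mul_le_mul (norm_matEntry_le _ _ _) (norm_matEntry_le _ _ _) (norm_nonneg _)
        (norm_nonneg _)
    have hκ' := fun x y (h : matEntry (a : BEll2 (BranchingTree n)) x y * roeEntry y x b ≠ 0) =>
      hκ x y (left_ne_zero_of_mul h)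
    have h1 : roeExpect (b * a) = ∑ p ∈ P, shift p.2 (kernelPiece _ hc κ p) := by
      ext y
      exact (matEntry_mul (b : BEll2 (BranchingTree n)) a y y).unique
        (hasSum_kernel_left _ hc κ hκ' y)
    have h2 : roeExpect (a * F (Complex.I * β)) = ∑ p ∈ P,
        ((Real.exp (-β * (p.2.length - p.1.length)) : ℝ) : ℂ) •
          shift p.1 (kernelPiece _ hc κ p) := by
      ext x
      have h := matEntry_mul (a : BEll2 (BranchingTree n)) (F (Complex.I * β)) x x
      refine h.unique ?_
      convert hasSum_kernel_right _ hc κ hκ' (fun s => (Real.exp (-β * s) : ℝ)) x using 2 with y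
      rw [← roeEntry_apply, hF.roeEntry_eq, ← mul_assoc, Complex.I_mul_I, mul_right_comm, ← mul_assoc]
      congr 2
      rw [Complex.ofReal_exp]
      push_cast
      rw [neg_one_mul]
    -- The piece of (z, w) has factor e^{-β|w|} on both sides; on one of them it arises as
    -- e^{-β(|w|-|z|)} e^{-β|z|}.
    rw [ContinuousLinearMap.comp_apply, ContinuousLinearMap.comp_apply, h1, h2, map_sum, map_sum]
    refine Finset.sum_congr rfl fun p _ => ?_
    rw [map_smul, hm.map_shift, hm.map_shift, smul_eq_mul, ← mul_assoc, ← Complex.ofReal_mul,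
      ← Real.exp_add]
    congr 3
    ring

end BranchingTree

/-! ### Compact operators -/

theorem finite_setOf_le_norm_apply {X : Type*} (f : Ell2 X) {ε : ℝ} (hε : 0 < ε) :
    {x | ε ≤ ‖f x‖}.Finite := by
  have h := (hasSum_smul_deltaVec f).summable.tendsto_cofinite_zero.norm
  rw [norm_zero] at h
  have := (h.eventually (gt_mem_nhds hε))
  rw [Filter.eventually_cofinite] at this
  refine this.subset fun x hx => ?_
  rw [Set.mem_ofPred_eq, norm_smul, norm_deltaVec, mul_one]
  exact not_lt.2 hx

/-- The vectors a δ_x lie in a compact set. Each of the finitely many centres of an ε/2-net has only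
finitely many coordinates of size at least ε/2. -/
theorem IsCompactOperator.finite_setOf_le_norm_matEntry {X : Type*} {a : BEll2 X}
    (ha : IsCompactOperator a) {ε : ℝ} (hε : 0 < ε) : {x | ε ≤ ‖matEntry a x x‖}.Finite := by
  obtain ⟨K, hK, haK⟩ := IsCompactOperator.image_closedBall_subset_compact
    (f := (a : Ell2 X →ₗ[ℂ] Ell2 X)) ha 1
  obtain ⟨t, ht, hKt⟩ := Metric.totallyBounded_iff.1 hK.totallyBounded (ε / 2) (half_pos hε)
  refine (ht.biUnion fun v _ => finite_setOf_le_norm_apply v (half_pos hε)).subset fun x hx => ?_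
  have hx' : a (deltaVec x) ∈ K := haK ⟨deltaVec x, by
    rw [mem_closedBall_zero_iff, norm_deltaVec], rfl⟩
  obtain ⟨v, hv, hxv⟩ := Set.mem_iUnion₂.1 (hKt hx')
  refine Set.mem_iUnion₂.2 ⟨v, hv, ?_⟩
  rw [Metric.mem_ball, dist_eq_norm] at hxv
  have h1 : ‖matEntry a x x - v x‖ < ε / 2 := by
    refine lt_of_le_of_lt ?_ hxv
    have := lp.norm_apply_le_norm (p := 2) (by simp) (a (deltaVec x) - v) x
    rwa [lp.coeFn_sub, Pi.sub_apply] at this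
  have h2 := norm_sub_norm_le (matEntry a x x) (v x)
  rw [Set.mem_ofPred_eq] at hx ⊢
  linarith

namespace BranchingTree

variable {n : ℕ}

/-! ### Point masses -/

/-- The mass which a KMS state gives to a vertex. -/
def kmsWeight (β : ℝ) (y : BranchingTree n) : ℝ :=
  Real.exp (-β * y.length) - n * Real.exp (-β * (y.length + 1))

theorem kmsWeight_eq (β : ℝ) (y : BranchingTree n) :
    kmsWeight β y = Real.exp (-β * y.length) * (1 - n * Real.exp (-β)) := by
  rw [kmsWeight, mul_add, Real.exp_add, mul_one]
  ring

theorem kmsWeight_snoc (β : ℝ) (y : BranchingTree n) (k : Fin n) :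
    kmsWeight β (y.snoc k) = Real.exp (-β) * kmsWeight β y := by
  rw [kmsWeight_eq, kmsWeight_eq, length_snoc, Nat.cast_add, Nat.cast_one, mul_add, Real.exp_add,
    mul_one]
  ring

/-- The words with a given last letter have total mass e^{-β}, so the root receives what n such sets
leave over. -/
theorem IsConformal.map_ind_root {β : ℝ} {m : EllInf (BranchingTree n) →L[ℂ] ℂ}
    (hm : IsConformal β m) : m (EllInf.ind {root n}) = (1 - n * Real.exp (-β) : ℝ) := by
  have h := congrArg m (one_eq_ind_root_add_sum (n := n))
  rw [map_add, map_sum, hm.map_one] at h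
  simp only [hm.map_shift_singleton, hm.map_one, mul_one, Finset.sum_const, Finset.card_univ,
    Fintype.card_fin, nsmul_eq_mul] at h
  rw [eq_comm, ← eq_sub_iff_add_eq] at h
  rw [h]
  push_cast
  ring

theorem IsConformal.map_ind_singleton {β : ℝ} {m : EllInf (BranchingTree n) →L[ℂ] ℂ}
    (hm : IsConformal β m) (y : BranchingTree n) : m (EllInf.ind {y}) = kmsWeight β y := by
  obtain ⟨w, hw, hy⟩ := exists_eq_root_append y
  rw [hy, ind_singleton_append, hm.map_shift, hm.map_ind_root, kmsWeight_eq, Complex.ofReal_mul,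
    ← hy, hw]

theorem IsConformal.log_le {β : ℝ} {m : EllInf (BranchingTree n) →L[ℂ] ℂ}
    (hm : IsConformal β m) (hn : 1 ≤ n) : Real.log n ≤ β := by
  have h := hm.isPositive _ (EllInf.ind_nonneg {root n})
  rw [hm.map_ind_root, Complex.zero_le_real, sub_nonneg, Real.exp_neg, ← div_eq_mul_inv,
    div_le_one (Real.exp_pos β)] at h
  exact (Real.log_le_iff_le_exp (by exact_mod_cast hn)).2 h

/-! ### Low temperature -/

theorem natCast_mul_exp_neg_lt_one {β : ℝ} (hn : 1 ≤ n) (hβ : Real.log n < β) :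
    n * Real.exp (-β) < 1 := by
  rw [Real.exp_neg, ← div_eq_mul_inv, div_lt_one (Real.exp_pos β)]
  exact (Real.log_lt_iff_lt_exp (by exact_mod_cast hn)).1 hβ

theorem kmsWeight_nonneg {β : ℝ} (hn : 1 ≤ n) (hβ : Real.log n < β) (y : BranchingTree n) :
    0 ≤ kmsWeight β y := by
  rw [kmsWeight_eq]
  exact mul_nonneg (Real.exp_pos _).le (sub_nonneg.2 (natCast_mul_exp_neg_lt_one hn hβ).le)

/-- There are n^k words of length k, each of weight e^{-βk}(1 - q) with q = n e^{-β}; the levels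
form a geometric series of ratio q. -/
theorem hasSum_kmsWeight {β : ℝ} (hn : 1 ≤ n) (hβ : Real.log n < β) :
    HasSum (fun y : BranchingTree n => kmsWeight β y) 1 := by
  set q : ℝ := n * Real.exp (-β) with hq
  have hq0 : 0 ≤ q := by positivity
  have hq1 : q < 1 := natCast_mul_exp_neg_lt_one hn hβ
  let e : (Σ k, Fin k → Fin n) ≃ BranchingTree n := (List.equivSigmaTuple (α := Fin n)).symm
  rw [← e.hasSum_iff]
  have hlen : ∀ (k : ℕ) (f : Fin k → Fin n), (e ⟨k, f⟩).length = k := fun k f => by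
    change (List.ofFn f).length = k
    simp
  have hterm : ∀ (k : ℕ) (f : Fin k → Fin n),
      kmsWeight β (e ⟨k, f⟩) = Real.exp (-β) ^ k * (1 - q) := fun k f => by
    rw [kmsWeight_eq, hlen, ← Real.exp_nat_mul, mul_comm (-β)]
  have hfib : ∀ k : ℕ, HasSum (fun f : Fin k → Fin n => kmsWeight β (e ⟨k, f⟩))
      (q ^ k * (1 - q)) := fun k => by
    convert hasSum_fintype (fun f : Fin k → Fin n => kmsWeight β (e ⟨k, f⟩)) using 1
    simp only [hterm, Finset.sum_const, Finset.card_univ, Fintype.card_fun, Fintype.card_fin,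
      nsmul_eq_mul, hq, mul_pow, Nat.cast_pow]
    ring
  have hgeom : HasSum (fun k : ℕ => q ^ k * (1 - q)) 1 := by
    have := (hasSum_geometric_of_lt_one hq0 hq1).mul_right (1 - q)
    rwa [inv_mul_cancel₀ (sub_pos.2 hq1).ne'] at this
  have hsum : Summable ((fun y : BranchingTree n => kmsWeight β y) ∘ e) := by
    refine (summable_sigma_of_nonneg fun x => kmsWeight_nonneg hn hβ (e x)).2 ⟨fun k => (hfib k).summable, ?_⟩
    convert hgeom.summable using 2 with k
    exact (hfib k).tsum_eq
  have := hsum.hasSum.sigma hfib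
  rw [← this.unique hgeom]
  exact hsum.hasSum

theorem summable_mul_kmsWeight {β : ℝ} (hn : 1 ≤ n) (hβ : Real.log n < β)
    (f : EllInf (BranchingTree n)) : Summable fun y => f y * (kmsWeight β y : ℂ) := by
  refine Summable.of_norm_bounded ((hasSum_kmsWeight hn hβ).summable.mul_left ‖f‖) fun y => ?_
  rw [norm_mul, Complex.norm_real, Real.norm_of_nonneg (kmsWeight_nonneg hn hβ y)]
  exact mul_le_mul_of_nonneg_right (f.norm_apply_le y) (kmsWeight_nonneg hn hβ y)

/-- The functional `f ↦ ∑ f(y) (e^{-β|y|} - n e^{-β(|y|+1)})`. -/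
def gibbs {β : ℝ} (hn : 1 ≤ n) (hβ : Real.log n < β) : EllInf (BranchingTree n) →L[ℂ] ℂ :=
  LinearMap.mkContinuous
    { toFun := fun f => ∑' y, f y * (kmsWeight β y : ℂ)
      map_add' := fun f g => by
        rw [← (summable_mul_kmsWeight hn hβ f).tsum_add (summable_mul_kmsWeight hn hβ g)]
        refine tsum_congr fun y => ?_
        rw [EllInf.add_apply, add_mul]
      map_smul' := fun c f => by
        rw [RingHom.id_apply, smul_eq_mul, ← tsum_mul_left]
        refine tsum_congr fun y => ?_
        rw [EllInf.smul_apply, mul_assoc] } 1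
    (fun f => by
      rw [one_mul]
      have h := (hasSum_kmsWeight (n := n) hn hβ).mul_left ‖f‖
      rw [mul_one] at h
      refine tsum_of_norm_bounded h fun y => ?_
      rw [norm_mul, Complex.norm_real, Real.norm_of_nonneg (kmsWeight_nonneg hn hβ y)]
      exact mul_le_mul_of_nonneg_right (f.norm_apply_le y) (kmsWeight_nonneg hn hβ y))

theorem gibbs_apply {β : ℝ} (hn : 1 ≤ n) (hβ : Real.log n < β) (f : EllInf (BranchingTree n)) :
    gibbs hn hβ f = ∑' y, f y * (kmsWeight β y : ℂ) := rfl

theorem isConformal_gibbs {β : ℝ} (hn : 1 ≤ n) (hβ : Real.log n < β) :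
    IsConformal β (gibbs (n := n) hn hβ) where
  isPositive f hf := tsum_nonneg fun y =>
    mul_nonneg (hf y) (Complex.zero_le_real.2 (kmsWeight_nonneg hn hβ y))
  map_one := by
    rw [gibbs_apply]
    simp only [EllInf.one_apply, one_mul]
    rw [← Complex.ofReal_tsum, (hasSum_kmsWeight hn hβ).tsum_eq, Complex.ofReal_one]
  map_shift_singleton k g := by
    rw [gibbs_apply, gibbs_apply, ← tsum_mul_left, ← (snoc_injective k).tsum_eq]
    · refine tsum_congr fun u => ?_
      rw [shift_singleton_snoc, kmsWeight_snoc, Complex.ofReal_mul]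
      ring
    · intro y hy
      by_contra h
      refine hy (mul_eq_zero_of_left ?_ _)
      exact shift_of_not [k] g fun u hu => h ⟨u, hu.symm⟩

/-- The point masses already sum to 1, so the complement of a large finite set has small mass and
positivity bounds the remainder of m f. -/
theorem IsConformal.hasSum {β : ℝ} (hn : 1 ≤ n) (hβ : Real.log n < β)
    {m : EllInf (BranchingTree n) →L[ℂ] ℂ} (hm : IsConformal β m)
    (f : EllInf (BranchingTree n)) : HasSum (fun y => f y * (kmsWeight β y : ℂ)) (m f) := by
  have hb : ∀ s : Finset (BranchingTree n),
      ‖∑ y ∈ s, f y * (kmsWeight β y : ℂ) - m f‖ ≤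
        2 * (‖f‖ * (1 - ∑ y ∈ s, kmsWeight β y)) := by
    classical
    intro s
    have h1 : ∑ y ∈ s, f y * (kmsWeight β y : ℂ) =
        m (∑ y ∈ s, f y • EllInf.ind {y}) := by
      rw [map_sum]
      refine Finset.sum_congr rfl fun y _ => ?_
      rw [map_smul, hm.map_ind_singleton, smul_eq_mul]
    have h2 : ∀ (g : EllInf (BranchingTree n)) (x : BranchingTree n),
        (∑ y ∈ s, g y • EllInf.ind {y}) x = if x ∈ s then g x else 0 := by
      intro g x
      rw [EllInf.sum_apply, ← Finset.sum_ite_eq s x fun y => g y]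
      refine Finset.sum_congr rfl fun y _ => ?_
      rw [EllInf.smul_apply]
      split_ifs with h
      · rw [h, EllInf.ind_singleton_self, mul_one]
      · rw [EllInf.ind_singleton_of_ne h, mul_zero]
    have h3 : m (EllInf.ind (↑s : Set (BranchingTree n))ᶜ) =
        (1 - ∑ y ∈ s, kmsWeight β y : ℝ) := by
      have : EllInf.ind (↑s : Set (BranchingTree n)) =
          ∑ y ∈ s, (1 : EllInf (BranchingTree n)) y • EllInf.ind {y} := by
        ext x
        rw [h2, EllInf.one_apply]
        split_ifs with h
        · exact EllInf.ind_of_mem h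
        · exact EllInf.ind_of_notMem h
      rw [EllInf.ind_compl, map_sub, hm.map_one, this, map_sum]
      simp only [hm.map_ind_singleton, EllInf.one_apply, one_smul]
      push_cast
      rfl
    have h4 := hm.isPositive.norm_apply_le_norm_mul_ind (f := f - ∑ y ∈ s, f y • EllInf.ind {y})
      (C := ‖f‖) (S := (↑s : Set (BranchingTree n))ᶜ)
      (fun x => by
        rw [EllInf.sub_apply, h2]
        split_ifs
        · rw [sub_self, norm_zero]; exact norm_nonneg _
        · rw [sub_zero]; exact f.norm_apply_le x)
      (fun x hx => by
        rw [EllInf.sub_apply, h2, if_pos (by simpa using hx), sub_self])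
    rw [h3, Complex.ofReal_re, map_sub, ← h1] at h4
    rwa [norm_sub_rev]
  have hlim : Filter.Tendsto (fun s : Finset (BranchingTree n) =>
      2 * (‖f‖ * (1 - ∑ y ∈ s, kmsWeight β y))) Filter.atTop (nhds 0) := by
    have h : Filter.Tendsto (fun s : Finset (BranchingTree n) => ∑ y ∈ s, kmsWeight β y)
      Filter.atTop (nhds 1) := hasSum_kmsWeight (n := n) hn hβ
    simpa using (((h.const_sub 1).const_mul ‖f‖).const_mul 2)
  exact tendsto_iff_norm_sub_tendsto_zero.2 (squeeze_zero (fun _ => norm_nonneg _) hb hlim)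

/-- Strong convergence gives convergence of each diagonal entry, and r · p dominates; dominated
convergence for series holds along arbitrary filters. -/
theorem isStronglyContinuous_of_hasSum {X : Type*} [MetricSpace X] {p : X → ℝ} (hp : Summable p)
    (hp0 : ∀ x, 0 ≤ p x) {φ : uniformRoeAlgebra X →L[ℂ] ℂ}
    (hφ : ∀ a : uniformRoeAlgebra X, HasSum (fun y => matEntry (a : BEll2 X) y y * (p y : ℂ)) (φ a)) :
    IsStronglyContinuous φ := by
  intro l a r hr hl
  have hφ' : (φ : uniformRoeAlgebra X → ℂ) =
      fun a : uniformRoeAlgebra X => ∑' y, matEntry (a : BEll2 X) y y * (p y : ℂ) :=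
    funext fun a => (hφ a).tsum_eq.symm
  rw [hφ']
  refine tendsto_tsum_of_dominated_convergence (hp.mul_left r) (fun y => ?_) ?_
  · refine Filter.Tendsto.mul_const _ ?_
    have := ((innerSL ℂ (deltaVec y : Ell2 X)).continuous.tendsto _).comp (hl (deltaVec y))
    simp only [innerSL_apply_apply, Function.comp_def, inner_deltaVec] at this
    exact this
  · filter_upwards [hr] with b hb y
    rw [norm_mul, Complex.norm_real, Real.norm_of_nonneg (hp0 y)]
    exact mul_le_mul_of_nonneg_right ((norm_matEntry_le _ y y).trans hb) (hp0 y)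

theorem exists_kmsStates_eq_singleton {β : ℝ} (hn : 1 ≤ n) (hβ : Real.log n < β) :
    ∃ φ : uniformRoeAlgebra (BranchingTree n) →L[ℂ] ℂ,
      kmsStates n β = {φ} ∧ IsStronglyContinuous φ ∧
      ∀ a : uniformRoeAlgebra (BranchingTree n),
        HasSum (fun y => matEntry (a : BEll2 (BranchingTree n)) y y * (kmsWeight β y : ℂ))
          (φ a) := by
  have hsum : ∀ φ ∈ kmsStates n β, ∀ a : uniformRoeAlgebra (BranchingTree n),
      HasSum (fun y => matEntry (a : BEll2 (BranchingTree n)) y y * (kmsWeight β y : ℂ))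
        (φ a) := fun φ hφ a => by
    rw [apply_eq_apply_roeDiag_roeExpect hφ a]
    exact (isConformal_of_mem_kmsStates hφ).hasSum hn hβ (roeExpect a)
  have hmem := (isConformal_gibbs hn hβ).comp_roeExpect_mem_kmsStates
  refine ⟨_, Set.eq_singleton_iff_unique_mem.2 ⟨hmem, fun φ hφ => ?_⟩,
    isStronglyContinuous_of_hasSum (hasSum_kmsWeight hn hβ).summable (kmsWeight_nonneg hn hβ)
      (hsum _ hmem), hsum _ hmem⟩
  ext a
  exact (hsum φ hφ a).unique (hsum _ hmem a)

/-! ### The critical temperature -/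

theorem natCast_mul_exp_neg_log (hn : 1 ≤ n) : n * Real.exp (-Real.log n) = 1 := by
  have : (0 : ℝ) < n := by exact_mod_cast hn
  rw [Real.exp_neg, Real.exp_log this, mul_inv_cancel₀ this.ne']

theorem IsConformal.map_ind_finite (hn : 1 ≤ n) {m : EllInf (BranchingTree n) →L[ℂ] ℂ}
    (hm : IsConformal (Real.log n) m) {S : Set (BranchingTree n)} (hS : S.Finite) :
    m (EllInf.ind S) = 0 := by
  induction S, hS using Set.Finite.induction_on with
  | empty =>
    have : EllInf.ind (∅ : Set (BranchingTree n)) = 0 := by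
      ext x; exact EllInf.ind_of_notMem (Set.notMem_empty x)
    rw [this, map_zero]
  | @insert a S ha _ ih =>
    rw [Set.insert_eq, EllInf.ind_union (Set.disjoint_singleton_left.2 ha), map_add, ih,
      hm.map_ind_singleton, kmsWeight_eq, natCast_mul_exp_neg_log hn, sub_self, mul_zero,
      Complex.ofReal_zero, add_zero]

theorem IsConformal.map_eq_zero_of_finite (hn : 1 ≤ n) {m : EllInf (BranchingTree n) →L[ℂ] ℂ}
    (hm : IsConformal (Real.log n) m) {f : EllInf (BranchingTree n)}
    {S : Set (BranchingTree n)} (hS : S.Finite) (hf : ∀ x ∉ S, f x = 0) : m f = 0 := by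
  have h := hm.isPositive.norm_apply_le_norm_mul_ind f.norm_apply_le hf
  rw [hm.map_ind_finite hn hS, Complex.zero_re, mul_zero, mul_zero] at h
  exact norm_le_zero_iff.1 h

/-- A family tending to 0 at infinity is uniformly close to a finitely supported one, and finite
sets are null. -/
theorem IsConformal.map_eq_zero_of_forall_finite (hn : 1 ≤ n)
    {m : EllInf (BranchingTree n) →L[ℂ] ℂ} (hm : IsConformal (Real.log n) m)
    {f : EllInf (BranchingTree n)} (hf : ∀ ε > 0, {x | ε ≤ ‖f x‖}.Finite) : m f = 0 := by
  refine norm_le_zero_iff.1 (le_of_forall_pos_le_add fun ε hε => ?_)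
  have hε' : 0 < ε / 2 := half_pos hε
  set S := {x | ε / 2 ≤ ‖f x‖}
  have h1 : m (EllInf.ind S * f) = 0 :=
    hm.map_eq_zero_of_finite hn (hf _ hε') fun x hx => by
      rw [EllInf.mul_apply, EllInf.ind_of_notMem hx, zero_mul]
  have h2 : ‖m (f - EllInf.ind S * f)‖ ≤ 2 * (ε / 2) := by
    refine (hm.isPositive.norm_le hm.map_one _).trans ?_
    refine mul_le_mul_of_nonneg_left (EllInf.norm_le hε'.le fun x => ?_) two_pos.le
    rw [EllInf.sub_apply, EllInf.mul_apply]
    by_cases hx : x ∈ S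
    · rw [EllInf.ind_of_mem hx, one_mul, sub_self, norm_zero]
      exact hε'.le
    · rw [EllInf.ind_of_notMem hx, zero_mul, sub_zero]
      exact (not_le.1 hx).le
  rw [map_sub, h1, sub_zero] at h2
  linarith

theorem vanishesOnCompacts_of_mem_kmsStates (hn : 1 ≤ n)
    {φ : uniformRoeAlgebra (BranchingTree n) →L[ℂ] ℂ} (hφ : φ ∈ kmsStates n (Real.log n)) :
    VanishesOnCompacts φ := fun a ha => by
  rw [apply_eq_apply_roeDiag_roeExpect hφ a]
  exact (isConformal_of_mem_kmsStates hφ).map_eq_zero_of_forall_finite hn fun ε hε =>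
    ha.finite_setOf_le_norm_matEntry hε

/-! ### Almost invariant sets -/

/-- A set of words such that, up to finitely many exceptions, a word belongs to it if and only if
the word with a letter added at its end does. -/
def IsAlmostInvariant (C : Set (BranchingTree n)) : Prop :=
  ∀ k : Fin n, {u : BranchingTree n | ¬(u.snoc k ∈ C ↔ u ∈ C)}.Finite

theorem IsAlmostInvariant.compl {C : Set (BranchingTree n)} (hC : IsAlmostInvariant C) :
    IsAlmostInvariant Cᶜ := fun k => by
  simpa only [Set.mem_compl_iff, not_iff_not] using hC k

/-- The functional `f ↦ m (1_C f)`. -/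
def restrict (m : EllInf (BranchingTree n) →L[ℂ] ℂ) (C : Set (BranchingTree n)) :
    EllInf (BranchingTree n) →L[ℂ] ℂ :=
  m.comp (ContinuousLinearMap.mul ℂ (EllInf (BranchingTree n)) (EllInf.ind C))

theorem restrict_apply (m : EllInf (BranchingTree n) →L[ℂ] ℂ) (C : Set (BranchingTree n))
    (f : EllInf (BranchingTree n)) : restrict m C f = m (EllInf.ind C * f) := rfl

/-- Restricting to C commutes with the shift except at finitely many words, and these carry no mass
at the critical temperature. -/
theorem IsConformal.normalize_restrict (hn : 1 ≤ n) {m : EllInf (BranchingTree n) →L[ℂ] ℂ}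
    (hm : IsConformal (Real.log n) m) {C : Set (BranchingTree n)} (hC : IsAlmostInvariant C)
    {s : ℝ} (hs : m (EllInf.ind C) = s) (h0 : 0 < s) :
    IsConformal (Real.log n) (((s⁻¹ : ℝ) : ℂ) • restrict m C) where
  isPositive f hf := by
    rw [smul_apply, restrict_apply, smul_eq_mul]
    refine mul_nonneg (Complex.zero_le_real.2 (inv_nonneg.2 h0.le)) (hm.isPositive _ fun x => ?_)
    rw [EllInf.mul_apply]
    exact mul_nonneg (EllInf.ind_nonneg C x) (hf x)
  map_one := by
    rw [smul_apply, restrict_apply, mul_one, hs, smul_eq_mul,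
      ← Complex.ofReal_mul, inv_mul_cancel₀ h0.ne', Complex.ofReal_one]
  map_shift_singleton k g := by
    rw [smul_apply, smul_apply, restrict_apply,
      restrict_apply, smul_eq_mul, smul_eq_mul, mul_left_comm, ← hm.map_shift_singleton]
    congr 1
    rw [← sub_eq_zero, ← map_sub]
    refine hm.map_eq_zero_of_finite hn ((hC k).image fun u => u.snoc k) fun y hy => ?_
    rw [EllInf.sub_apply, EllInf.mul_apply]
    by_cases h : ∃ u, y = snoc u k
    · obtain ⟨u, rfl⟩ := h
      rw [shift_singleton_snoc, shift_singleton_snoc, EllInf.mul_apply]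
      have hu : u.snoc k ∈ C ↔ u ∈ C := by
        by_contra h'
        exact hy ⟨u, h', rfl⟩
      by_cases huC : u ∈ C
      · rw [EllInf.ind_of_mem huC, EllInf.ind_of_mem (hu.2 huC), sub_self]
      · rw [EllInf.ind_of_notMem huC, EllInf.ind_of_notMem (fun h' => huC (hu.1 h')), sub_self]
    · push Not at h
      rw [shift_of_not [k] _ h, shift_of_not [k] _ h, mul_zero, sub_self]

theorem exists_apply_roeProj {β : ℝ} {φ : uniformRoeAlgebra (BranchingTree n) →L[ℂ] ℂ}
    (hφ : φ ∈ kmsStates n β) (C : Set (BranchingTree n)) :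
    ∃ s : ℝ, φ (roeProj C) = s ∧ 0 ≤ s ∧ s ≤ 1 := by
  have hm := isConformal_of_mem_kmsStates hφ
  have h0 := hm.isPositive _ (EllInf.ind_nonneg C)
  have h1 := hm.isPositive.mono (f := EllInf.ind C) (g := 1) fun x => by
    rw [EllInf.one_apply]; exact EllInf.ind_le C x
  rw [hm.map_one] at h1
  rw [ContinuousLinearMap.comp_apply, roeDiag_ind] at h0 h1
  refine ⟨(φ (roeProj C)).re, Complex.ext rfl ?_, ?_, ?_⟩
  · rw [Complex.ofReal_im]
    exact (Complex.le_def.1 h0).2.symm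
  · exact (Complex.le_def.1 h0).1
  · exact (Complex.le_def.1 h1).1

/-- A zero-one law: if 0 < s < 1, conditioning on C and on its complement would write φ as a proper
convex combination of two KMS states. -/
theorem IsAlmostInvariant.apply_eq_zero_or_one (hn : 1 ≤ n) {C : Set (BranchingTree n)}
    (hC : IsAlmostInvariant C) {φ : uniformRoeAlgebra (BranchingTree n) →L[ℂ] ℂ}
    (hφ : φ ∈ extremeKMSStates n (Real.log n)) :
    φ (roeProj C) = 0 ∨ φ (roeProj C) = 1 := by
  obtain ⟨s, hs, h0, h1⟩ := exists_apply_roeProj hφ.1 C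
  rcases h0.eq_or_lt with rfl | h0
  · exact Or.inl (by rw [hs, Complex.ofReal_zero])
  rcases h1.eq_or_lt with rfl | h1
  · exact Or.inr (by rw [hs, Complex.ofReal_one])
  exfalso
  have hm := isConformal_of_mem_kmsStates hφ.1
  have hsC : (φ.comp roeDiag) (EllInf.ind C) = s := hs
  have hsC' : (φ.comp roeDiag) (EllInf.ind Cᶜ) = (1 - s : ℝ) := by
    rw [EllInf.ind_compl, map_sub, hm.map_one, hsC]
    push_cast
    rfl
  have h1s : 0 < 1 - s := sub_pos.2 h1
  have hm1 := hm.normalize_restrict hn hC hsC h0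
  have hm2 := hm.normalize_restrict hn hC.compl hsC' h1s
  have key := (mem_extremePoints_iff_left.1 hφ).2 _ hm1.comp_roeExpect_mem_kmsStates _
    hm2.comp_roeExpect_mem_kmsStates ⟨s, 1 - s, h0, h1s, add_sub_cancel _ _, by
      ext a
      rw [apply_eq_apply_roeDiag_roeExpect hφ.1 a]
      change (s : ℂ) * (((s⁻¹ : ℝ) : ℂ) * (φ.comp roeDiag) (EllInf.ind C * roeExpect a)) +
        ((1 - s : ℝ) : ℂ) * ((((1 - s)⁻¹ : ℝ) : ℂ) *
          (φ.comp roeDiag) (EllInf.ind Cᶜ * roeExpect a)) = (φ.comp roeDiag) (roeExpect a)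
      rw [← mul_assoc, ← mul_assoc, ← Complex.ofReal_mul, ← Complex.ofReal_mul,
        mul_inv_cancel₀ h0.ne', mul_inv_cancel₀ h1s.ne', Complex.ofReal_one, one_mul, one_mul,
        ← map_add, ← add_mul, EllInf.ind_compl, add_sub_cancel, one_mul]⟩
  -- The state conditioned on C gives C mass 1, so equality with φ would force s = 1.
  have h2 := DFunLike.congr_fun key (roeProj C)
  rw [hs, ← roeDiag_ind, ContinuousLinearMap.comp_apply, roeExpect_roeDiag,
    smul_apply, restrict_apply] at h2
  have h3 : EllInf.ind C * EllInf.ind C = EllInf.ind C := by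
    ext x
    rw [EllInf.mul_apply]
    by_cases hx : x ∈ C
    · rw [EllInf.ind_of_mem hx, one_mul]
    · rw [EllInf.ind_of_notMem hx, zero_mul]
  rw [h3, hsC, smul_eq_mul, ← Complex.ofReal_mul, inv_mul_cancel₀ h0.ne'] at h2
  exact h1.ne (Complex.ofReal_injective h2).symm

/-! ### Branches -/

/-- The set of words which start with `w`. -/
def cone (w : BranchingTree n) : Set (BranchingTree n) := {v | ∃ z : List (Fin n), v = w.append z}

/-- The word formed by the first `k` letters of a branch. -/
def branchPrefix (x : ℕ → Fin n) (k : ℕ) : BranchingTree n := List.ofFn fun i : Fin k => x i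

theorem branchCone_eq (x : ℕ → Fin n) (k : ℕ) : branchCone x k = cone (branchPrefix x k) := rfl

theorem branchPrefix_succ (x : ℕ → Fin n) (k : ℕ) :
    branchPrefix x (k + 1) = (branchPrefix x k).snoc (x k) :=
  List.ofFn_succ_last (f := fun i : Fin (k + 1) => x i)

theorem length_branchPrefix (x : ℕ → Fin n) (k : ℕ) : (branchPrefix x k).length = k := by
  change (List.ofFn fun i : Fin k => x i).length = k
  simp

theorem append_mem_cone (w : BranchingTree n) (z : List (Fin n)) : w.append z ∈ cone w :=
  ⟨z, rfl⟩

theorem snoc_mem_cone {u w : BranchingTree n} {k : Fin n} :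
    u.snoc k ∈ cone w ↔ u ∈ cone w ∨ u.snoc k = w := by
  constructor
  · rintro ⟨z, hz⟩
    rcases List.eq_nil_or_concat' z with rfl | ⟨z', j, rfl⟩
    · rw [append_nil] at hz
      exact Or.inr hz
    · rw [← append_append] at hz
      exact Or.inl ⟨z', (snoc_inj hz).1⟩
  · rintro (⟨z, rfl⟩ | h)
    · exact ⟨z ++ [k], append_append w z [k]⟩
    · exact ⟨[], by rw [append_nil, h]⟩

/-- Appending a letter can enter the cone only when it produces w itself, so the parent of w is the
only possible exception. -/
theorem isAlmostInvariant_cone (w : BranchingTree n) : IsAlmostInvariant (cone w) := fun k => by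
  refine ((Set.finite_singleton w).preimage (snoc_injective k).injOn).subset fun u hu => ?_
  rw [Set.mem_ofPred_eq, snoc_mem_cone] at hu
  rw [Set.mem_preimage, Set.mem_singleton_iff]
  tauto

theorem cone_root : cone (root n) = Set.univ :=
  Set.eq_univ_of_forall fun v => ⟨v, rfl⟩

theorem ind_cone (w : BranchingTree n) :
    EllInf.ind (cone w) = EllInf.ind {w} + ∑ k : Fin n, EllInf.ind (cone (w.snoc k)) := by
  ext v
  rw [EllInf.add_apply, EllInf.sum_apply]
  have hsnoc : ∀ k z, (w.snoc k).append z = w.append (k :: z) := fun k z =>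
    append_append w [k] z
  by_cases h : v ∈ cone w
  · obtain ⟨z, rfl⟩ := h
    rw [EllInf.ind_of_mem (append_mem_cone w z)]
    cases z with
    | nil =>
      rw [append_nil, EllInf.ind_singleton_self, Finset.sum_eq_zero, add_zero]
      rintro k -
      refine EllInf.ind_of_notMem ?_
      rintro ⟨z, hz⟩
      have := congrArg length hz
      rw [length_append, length_snoc] at this
      omega
    | cons j z =>
      rw [EllInf.ind_singleton_of_ne, zero_add, Finset.sum_eq_single j,
        EllInf.ind_of_mem (S := cone (w.snoc j)) (hsnoc j z ▸ append_mem_cone _ z)]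
      · rintro k - hk
        refine EllInf.ind_of_notMem ?_
        rintro ⟨z', hz'⟩
        rw [hsnoc] at hz'
        exact hk (List.cons.inj (append_right_injective w hz')).1.symm
      · simp
      · intro h
        have := congrArg length h
        rw [length_append, List.length_cons] at this
        omega
  · rw [EllInf.ind_of_notMem h, EllInf.ind_singleton_of_ne, Finset.sum_eq_zero, add_zero]
    · rintro k -
      refine EllInf.ind_of_notMem ?_
      rintro ⟨z, rfl⟩
      exact h ⟨k :: z, hsnoc k z⟩
    · rintro rfl
      exact h ⟨[], (append_nil v).symm⟩

/-- The vertex w is null, and the cones of its children have mass 0 or 1 each; they cannot all be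
null. -/
theorem exists_apply_cone_snoc_eq_one (hn : 1 ≤ n)
    {φ : uniformRoeAlgebra (BranchingTree n) →L[ℂ] ℂ}
    (hφ : φ ∈ extremeKMSStates n (Real.log n)) {w : BranchingTree n}
    (hw : φ (roeProj (cone w)) = 1) : ∃ k, φ (roeProj (cone (w.snoc k))) = 1 := by
  by_contra! h
  have hm := isConformal_of_mem_kmsStates hφ.1
  have h1 : (φ.comp roeDiag) (EllInf.ind (cone w)) = 1 := hw
  rw [ind_cone, map_add, hm.map_ind_finite hn (Set.finite_singleton w), map_sum,
    Finset.sum_eq_zero, add_zero] at h1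
  · exact zero_ne_one h1
  · rintro k -
    exact ((isAlmostInvariant_cone _).apply_eq_zero_or_one hn hφ).resolve_right (h k)

theorem exists_concentratedOn (hn : 1 ≤ n) {φ : uniformRoeAlgebra (BranchingTree n) →L[ℂ] ℂ}
    (hφ : φ ∈ extremeKMSStates n (Real.log n)) : ∃ x : ℕ → Fin n, ConcentratedOn φ x := by
  have h : ∀ w : BranchingTree n, ∃ k : Fin n, φ (roeProj (cone w)) = 1 →
      φ (roeProj (cone (w.snoc k))) = 1 := fun w => by
    by_cases hw : φ (roeProj (cone w)) = 1
    · obtain ⟨k, hk⟩ := exists_apply_cone_snoc_eq_one hn hφ hw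
      exact ⟨k, fun _ => hk⟩
    -- An arbitrary letter; the recursion below only meets cones of mass 1.
    · exact ⟨⟨0, hn⟩, fun h => absurd h hw⟩
  choose f hf using h
  let v : ℕ → BranchingTree n := fun k => Nat.rec (root n) (fun _ w => w.snoc (f w)) k
  have hv : ∀ k, branchPrefix (fun k => f (v k)) k = v k := fun k => by
    induction k with
    | zero => rfl
    | succ k ih => rw [branchPrefix_succ, ih]
  refine ⟨fun k => f (v k), fun k => ?_⟩
  rw [branchCone_eq, hv]
  induction k with
  | zero =>
    have hm := isConformal_of_mem_kmsStates hφ.1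
    have h1 : EllInf.ind (cone (root n)) = 1 := by
      ext x
      rw [EllInf.one_apply, EllInf.ind_of_mem]
      rw [cone_root]
      exact Set.mem_univ x
    have h2 := hm.map_one
    rw [← h1] at h2
    exact h2
  | succ k ih => exact hf _ ih

theorem disjoint_branchCone {x y : ℕ → Fin n} {i : ℕ} (h : x i ≠ y i) :
    Disjoint (branchCone x (i + 1)) (branchCone y (i + 1)) := by
  rw [Set.disjoint_left]
  rintro _ ⟨z, rfl⟩ ⟨z', hz⟩
  have := (List.append_inj hz (by simp)).1
  exact h (congrFun (List.ofFn_injective this) (Fin.last i))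

theorem not_apply_eq_one_of_disjoint {β : ℝ} {φ : uniformRoeAlgebra (BranchingTree n) →L[ℂ] ℂ}
    (hφ : φ ∈ kmsStates n β) {C D : Set (BranchingTree n)} (h : Disjoint C D)
    (hC : φ (roeProj C) = 1) (hD : φ (roeProj D) = 1) : False := by
  obtain ⟨s, hs, -, h1⟩ := exists_apply_roeProj hφ (C ∪ D)
  rw [← roeDiag_ind, EllInf.ind_union h, map_add, map_add, roeDiag_ind, roeDiag_ind, hC, hD] at hs
  have : (1 : ℝ) + 1 = s := by exact_mod_cast hs
  linarith

theorem ConcentratedOn.unique {β : ℝ} {φ : uniformRoeAlgebra (BranchingTree n) →L[ℂ] ℂ}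
    (hφ : φ ∈ kmsStates n β) {x y : ℕ → Fin n} (hx : ConcentratedOn φ x)
    (hy : ConcentratedOn φ y) : x = y := by
  by_contra h
  obtain ⟨i, hi⟩ := Function.ne_iff.1 h
  exact not_apply_eq_one_of_disjoint hφ (disjoint_branchCone hi) (hx (i + 1)) (hy (i + 1))

theorem existsUnique_concentratedOn (hn : 1 ≤ n)
    {φ : uniformRoeAlgebra (BranchingTree n) →L[ℂ] ℂ}
    (hφ : φ ∈ extremeKMSStates n (Real.log n)) : ∃! x : ℕ → Fin n, ConcentratedOn φ x := by
  obtain ⟨x, hx⟩ := exists_concentratedOn hn hφ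
  exact ⟨x, hx, fun _ hy => ConcentratedOn.unique hφ.1 hy hx⟩

/-! ### Averaging over subtrees -/

theorem norm_markovFun_le (f : EllInf (BranchingTree n)) (u : BranchingTree n) :
    ‖(n : ℂ)⁻¹ * ∑ k : Fin n, f (u.snoc k)‖ ≤ ‖f‖ := by
  rw [norm_mul, norm_inv, Complex.norm_natCast]
  have h : ‖∑ k : Fin n, f (u.snoc k)‖ ≤ n * ‖f‖ := by
    refine (norm_sum_le_of_le _ fun k _ => f.norm_apply_le (u.snoc k)).trans ?_
    simp
  rcases Nat.eq_zero_or_pos n with h0 | h0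
  · have : (n : ℝ) = 0 := by exact_mod_cast h0
    rw [this, inv_zero, zero_mul]
    exact norm_nonneg f
  · have : (0 : ℝ) < n := by exact_mod_cast h0
    rwa [inv_mul_le_iff₀ this]

/-- The Markov operator of the walk which adds a uniformly distributed letter at the end. -/
def markov : EllInf (BranchingTree n) →L[ℂ] EllInf (BranchingTree n) :=
  LinearMap.mkContinuous
    { toFun := fun f => EllInf.mk (fun u => (n : ℂ)⁻¹ * ∑ k : Fin n, f (u.snoc k))
        (norm_markovFun_le f)
      map_add' := fun f g => by
        ext u
        rw [EllInf.add_apply, EllInf.mk_apply, EllInf.mk_apply, EllInf.mk_apply, ← mul_add,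
          ← Finset.sum_add_distrib]
        rfl
      map_smul' := fun c f => by
        ext u
        rw [RingHom.id_apply, EllInf.smul_apply, EllInf.mk_apply, EllInf.mk_apply, mul_left_comm]
        congr 1
        rw [Finset.mul_sum]
        exact Finset.sum_congr rfl fun k _ => EllInf.smul_apply c f _ } 1
    (fun f => by
      rw [one_mul]
      exact EllInf.norm_le (norm_nonneg _) (norm_markovFun_le f))

theorem markov_apply (f : EllInf (BranchingTree n)) (u : BranchingTree n) :
    markov f u = (n : ℂ)⁻¹ * ∑ k : Fin n, f (u.snoc k) := rfl

/-- Exactly one of the n successors of a word ends in k. Hence a Markov invariant functional scales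
by 1/n = e^{-log n} under the shift. -/
theorem markov_shift_singleton (k : Fin n) (g : EllInf (BranchingTree n)) :
    markov (shift [k] g) = (n : ℂ)⁻¹ • g := by
  ext u
  rw [markov_apply, EllInf.smul_apply, Finset.sum_eq_single k, shift_singleton_snoc]
  · exact fun j _ hj => shift_singleton_snoc_of_ne hj g u
  · simp

theorem markov_pow_nonneg (i : ℕ) {f : EllInf (BranchingTree n)} (hf : ∀ u, 0 ≤ f u)
    (u : BranchingTree n) : 0 ≤ (markov ^ i) f u := by
  induction i generalizing u with
  | zero => exact hf u
  | succ i ih =>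
    rw [pow_succ', mul_apply_eq_comp, markov_apply]
    exact mul_nonneg (inv_nonneg.2 (Nat.cast_nonneg n)) (Finset.sum_nonneg fun k _ => ih _)

theorem markov_pow_apply_eq_one (hn : 1 ≤ n) (i : ℕ) {f : EllInf (BranchingTree n)}
    {u : BranchingTree n} (hf : ∀ z : List (Fin n), z.length = i → f (u.append z) = 1) :
    (markov ^ i) f u = 1 := by
  induction i generalizing u with
  | zero =>
    have := hf [] rfl
    rwa [append_nil] at this
  | succ i ih =>
    have hk : ∀ k : Fin n, (markov ^ i) f (u.snoc k) = 1 := fun k => ih fun z hz => by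
      rw [← append_singleton, append_append]
      exact hf _ (by simp [hz])
    have hs : ∑ k : Fin n, (markov ^ i) f (u.snoc k) = n :=
      (Finset.sum_congr rfl fun k _ => hk k).trans (by simp)
    rw [pow_succ', mul_apply_eq_comp, markov_apply, hs, inv_mul_cancel₀]
    exact Nat.cast_ne_zero.2 (by omega)

/-- The average of a family over the first `2 ^ k` levels of the subtree of the words which start
with `x|2 ^ k`. -/
def subtreeMean (x : ℕ → Fin n) (k : ℕ) : EllInf (BranchingTree n) →L[ℂ] ℂ :=
  ((2 : ℂ) ^ k)⁻¹ • (EllInf.eval (branchPrefix x (2 ^ k))).comp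
    (∑ i ∈ Finset.range (2 ^ k), markov ^ i)

theorem subtreeMean_apply (x : ℕ → Fin n) (k : ℕ) (f : EllInf (BranchingTree n)) :
    subtreeMean x k f =
      ((2 : ℂ) ^ k)⁻¹ * ∑ i ∈ Finset.range (2 ^ k), (markov ^ i) f (branchPrefix x (2 ^ k)) := by
  rw [subtreeMean, smul_apply, ContinuousLinearMap.comp_apply, EllInf.eval_apply, smul_eq_mul,
    sum_apply, EllInf.sum_apply]

theorem isPositive_subtreeMean (x : ℕ → Fin n) (k : ℕ) : EllInf.IsPositive (subtreeMean x k) :=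
  fun f hf => by
    rw [subtreeMean_apply]
    refine mul_nonneg (inv_nonneg.2 (pow_nonneg zero_le_two _))
      (Finset.sum_nonneg fun i _ => markov_pow_nonneg i hf _)

theorem subtreeMean_eq_one (hn : 1 ≤ n) (x : ℕ → Fin n) (k : ℕ) {f : EllInf (BranchingTree n)}
    (hf : ∀ z : List (Fin n), z.length < 2 ^ k → f ((branchPrefix x (2 ^ k)).append z) = 1) :
    subtreeMean x k f = 1 := by
  rw [subtreeMean_apply, Finset.sum_congr rfl fun i hi => markov_pow_apply_eq_one hn i
    fun z hz => hf z (hz ▸ Finset.mem_range.1 hi), Finset.sum_const, Finset.card_range,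
    nsmul_eq_mul, mul_one, Nat.cast_pow, Nat.cast_ofNat, inv_mul_cancel₀]
  exact pow_ne_zero _ two_ne_zero

theorem subtreeMean_one (hn : 1 ≤ n) (x : ℕ → Fin n) (k : ℕ) : subtreeMean x k 1 = 1 :=
  subtreeMean_eq_one hn x k fun _ _ => EllInf.one_apply _

theorem norm_markov_pow_apply_le (i : ℕ) (f : EllInf (BranchingTree n)) (u : BranchingTree n) :
    ‖(markov ^ i) f u‖ ≤ ‖f‖ := by
  induction i generalizing u with
  | zero => exact f.norm_apply_le u
  | succ i ih =>
    rw [pow_succ', mul_apply_eq_comp]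
    exact (norm_markovFun_le _ u).trans (EllInf.norm_le (norm_nonneg f) ih)

/-- The sum over the 2^k levels telescopes, leaving only its two end terms. -/
theorem norm_subtreeMean_markov_sub_le (x : ℕ → Fin n) (k : ℕ) (f : EllInf (BranchingTree n)) :
    ‖subtreeMean x k (markov f) - subtreeMean x k f‖ ≤ (1 / 2) ^ k * (2 * ‖f‖) := by
  have h : subtreeMean x k (markov f) - subtreeMean x k f = ((2 : ℂ) ^ k)⁻¹ *
      ((markov ^ (2 ^ k)) f (branchPrefix x (2 ^ k)) - f (branchPrefix x (2 ^ k))) := by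
    rw [subtreeMean_apply, subtreeMean_apply, ← mul_sub, ← Finset.sum_sub_distrib]
    congr 1
    have := Finset.sum_range_sub (fun i => (markov ^ i) f (branchPrefix x (2 ^ k))) (2 ^ k)
    rw [pow_zero] at this
    refine Eq.trans (Finset.sum_congr rfl fun i _ => ?_) this
    rw [pow_succ, mul_apply_eq_comp]
  rw [h, norm_mul, norm_inv, norm_pow, Complex.norm_ofNat, one_div, inv_pow]
  refine mul_le_mul_of_nonneg_left ?_ (by positivity)
  refine (norm_sub_le _ _).trans ?_
  rw [two_mul]
  exact add_le_add (norm_markov_pow_apply_le _ f _) (f.norm_apply_le _)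

/-- The words whose length has its binary logarithm in `S`. -/
def levelSet (n : ℕ) (S : Set ℕ) : Set (BranchingTree n) := {y | Nat.log 2 y.length ∈ S}

/-- The window for k consists of the lengths from 2^k to 2^(k+1) - 1, precisely those whose binary
logarithm is k. This lets a limit of the means recover the ultrafilter. -/
theorem subtreeMean_ind_levelSet (hn : 1 ≤ n) (x : ℕ → Fin n) {k : ℕ} {S : Set ℕ} (hk : k ∈ S) :
    subtreeMean x k (EllInf.ind (levelSet n S)) = 1 := by
  refine subtreeMean_eq_one hn x k fun z hz => EllInf.ind_of_mem ?_
  have : Nat.log 2 ((branchPrefix x (2 ^ k)).append z).length = k := by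
    rw [length_append, length_branchPrefix]
    exact Nat.log_eq_of_pow_le_of_lt_pow (by omega) (by rw [pow_succ]; omega)
  change Nat.log 2 _ ∈ S
  rwa [this]

theorem branchPrefix_mem_cone (x : ℕ → Fin n) {j k : ℕ} (h : j ≤ k) :
    branchPrefix x k ∈ cone (branchPrefix x j) := by
  induction k, h using Nat.le_induction with
  | base => exact ⟨[], (append_nil _).symm⟩
  | succ k _ ih =>
    rw [branchPrefix_succ]
    exact snoc_mem_cone.2 (Or.inl ih)

theorem subtreeMean_ind_branchCone (hn : 1 ≤ n) (x : ℕ → Fin n) {j k : ℕ} (h : j ≤ k) :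
    subtreeMean x k (EllInf.ind (branchCone x j)) = 1 := by
  refine subtreeMean_eq_one hn x k fun z _ => EllInf.ind_of_mem ?_
  obtain ⟨w, hw⟩ := branchPrefix_mem_cone x (h.trans k.lt_two_pow_self.le)
  exact ⟨w ++ z, by rw [hw, append_append]; rfl⟩

theorem exists_isConformal_of_ultrafilter (hn : 1 ≤ n) (x : ℕ → Fin n) {ω : Ultrafilter ℕ}
    (hω : (ω : Filter ℕ) ≤ Filter.atTop) :
    ∃ m : EllInf (BranchingTree n) →L[ℂ] ℂ, IsConformal (Real.log n) m ∧
      (∀ S ∈ ω, m (EllInf.ind (levelSet n S)) = 1) ∧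
      ∀ j, m (EllInf.ind (branchCone x j)) = 1 := by
  have hball : ∀ k, subtreeMean x k ∈ Metric.closedBall (0 : EllInf (BranchingTree n) →L[ℂ] ℂ) 2 :=
    fun k => mem_closedBall_zero_iff.2 (ContinuousLinearMap.opNorm_le_bound _ zero_le_two
      ((isPositive_subtreeMean x k).norm_le (subtreeMean_one hn x k)))
  -- Banach-Alaoglu: the ultrafilter limit of the means exists in the ball of radius 2.
  obtain ⟨m, -, hm⟩ := (WeakDual.isCompact_closedBall (𝕜 := ℂ)
    (0 : StrongDual ℂ (EllInf (BranchingTree n))) 2).ultrafilter_le_nhds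
      (ω.map fun k => StrongDual.toWeakDual (subtreeMean x k))
      (Filter.tendsto_principal.2 (Filter.Eventually.of_forall hball))
  have hlim : ∀ f, Filter.Tendsto (fun k => subtreeMean x k f) ω (nhds (m f)) := fun f =>
    ((WeakDual.eval_continuous f).tendsto m).comp hm
  have hone : ∀ f, (∀ᶠ k in (ω : Filter ℕ), subtreeMean x k f = 1) → m f = 1 := fun f hf =>
    tendsto_nhds_unique (hlim f) (tendsto_const_nhds.congr' (hf.mono fun _ h => h.symm))
  refine ⟨WeakDual.toStrongDual m, ⟨fun f hf => ?_, ?_, fun k g => ?_⟩, fun S hS => ?_,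
    fun j => ?_⟩
  · exact ge_of_tendsto' (hlim f) fun k => isPositive_subtreeMean x k f hf
  · exact hone 1 (Filter.Eventually.of_forall fun k => subtreeMean_one hn x k)
  -- The defect of invariance decays like 2^{-k}, and ω contains the tails of ℕ.
  · have hinv : ∀ f, m (markov f) = m f := fun f => by
      refine tendsto_nhds_unique (hlim (markov f)) ?_
      have h0 : Filter.Tendsto (fun k => subtreeMean x k (markov f) - subtreeMean x k f) ω
          (nhds 0) := by
        refine squeeze_zero_norm (fun k => norm_subtreeMean_markov_sub_le x k f) ?_
        have := (tendsto_pow_atTop_nhds_zero_of_lt_one (r := (1 / 2 : ℝ)) (by norm_num)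
          (by norm_num)).mul_const (2 * ‖f‖)
        rw [zero_mul] at this
        exact this.mono_left hω
      simpa using h0.add (hlim f)
    have h := hinv (shift [k] g)
    rw [markov_shift_singleton, map_smul, smul_eq_mul] at h
    refine h.symm.trans ?_
    have hn0 : (0 : ℝ) < n := by exact_mod_cast hn
    rw [Real.exp_neg, Real.exp_log hn0]
    push_cast
    rfl
  · refine hone _ ?_
    filter_upwards [hS] with k hk using subtreeMean_ind_levelSet hn x hk
  · refine hone _ ?_
    filter_upwards [hω (Filter.mem_atTop j)] with k hk using subtreeMean_ind_branchCone hn x hk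

/-! ### Extreme KMS states along a branch -/

/-- The KMS states which are concentrated on `x` and give full mass to the level sets of the
members of `ω`. -/
def kmsFace (x : ℕ → Fin n) (ω : Ultrafilter ℕ) :
    Set (uniformRoeAlgebra (BranchingTree n) →L[ℂ] ℂ) :=
  {φ ∈ kmsStates n (Real.log n) | (∀ S ∈ ω, φ (roeProj (levelSet n S)) = 1) ∧ ConcentratedOn φ x}

theorem nonempty_kmsFace (hn : 1 ≤ n) (x : ℕ → Fin n) {ω : Ultrafilter ℕ}
    (hω : (ω : Filter ℕ) ≤ Filter.atTop) : (kmsFace x ω).Nonempty := by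
  obtain ⟨m, hm, h1, h2⟩ := exists_isConformal_of_ultrafilter hn x hω
  have h : ∀ C, (m.comp roeExpect) (roeProj C) = m (EllInf.ind C) := fun C => by
    rw [← roeDiag_ind, ContinuousLinearMap.comp_apply, roeExpect_roeDiag]
  exact ⟨m.comp roeExpect, hm.comp_roeExpect_mem_kmsStates, fun S hS => (h _).trans (h1 S hS),
    fun j => (h _).trans (h2 j)⟩

/-- A proper convex combination of two numbers at most 1 equals 1 only if both do. -/
theorem apply_roeProj_eq_one_of_mem_openSegment {β : ℝ}
    {φ φ₁ φ₂ : uniformRoeAlgebra (BranchingTree n) →L[ℂ] ℂ} (h₁ : φ₁ ∈ kmsStates n β)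
    (h₂ : φ₂ ∈ kmsStates n β) (h : φ ∈ openSegment ℝ φ₁ φ₂) {C : Set (BranchingTree n)}
    (hC : φ (roeProj C) = 1) : φ₁ (roeProj C) = 1 := by
  obtain ⟨a, b, ha, hb, hab, rfl⟩ := h
  obtain ⟨s, hs, -, hs1⟩ := exists_apply_roeProj h₁ C
  obtain ⟨t, ht, -, ht1⟩ := exists_apply_roeProj h₂ C
  have h3 : (a : ℂ) * φ₁ (roeProj C) + (b : ℂ) * φ₂ (roeProj C) = 1 := hC
  rw [hs, ht] at h3
  have h4 : a * s + b * t = 1 := by exact_mod_cast h3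
  have h5 : s = 1 := by nlinarith
  rw [hs, h5, Complex.ofReal_one]

/-- Consequently the extreme points of this subset are extreme among all KMS states. -/
theorem isExtreme_kmsFace (x : ℕ → Fin n) (ω : Ultrafilter ℕ) :
    IsExtreme ℝ (kmsStates n (Real.log n)) (kmsFace x ω) where
  subset _ hφ := hφ.1
  left_mem_of_mem_openSegment _ h₁ _ h₂ _ hφ h :=
    ⟨h₁, fun S hS => apply_roeProj_eq_one_of_mem_openSegment h₁ h₂ h (hφ.2.1 S hS),
      fun j => apply_roeProj_eq_one_of_mem_openSegment h₁ h₂ h (hφ.2.2 j)⟩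

theorem norm_le_two_of_mem_kmsStates {β : ℝ} {φ : uniformRoeAlgebra (BranchingTree n) →L[ℂ] ℂ}
    (hφ : φ ∈ kmsStates n β) : ‖φ‖ ≤ 2 := by
  refine ContinuousLinearMap.opNorm_le_bound _ zero_le_two fun a => ?_
  have hm := isConformal_of_mem_kmsStates hφ
  rw [apply_eq_apply_roeDiag_roeExpect hφ a]
  refine (hm.isPositive.norm_le hm.map_one (roeExpect a)).trans ?_
  exact mul_le_mul_of_nonneg_left
    (EllInf.norm_le (norm_nonneg _) fun x => norm_matEntry_le _ x x) zero_le_two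

/-- Every defining condition compares values of φ at fixed elements, and evaluations are weak-*
continuous. -/
theorem isClosed_preimage_kmsFace (x : ℕ → Fin n) (ω : Ultrafilter ℕ) :
    IsClosed (WeakDual.toStrongDual ⁻¹' kmsFace x ω :
      Set (WeakDual ℂ (uniformRoeAlgebra (BranchingTree n)))) := by
  have hev := fun a : uniformRoeAlgebra (BranchingTree n) => WeakDual.eval_continuous (𝕜 := ℂ) a
  have h : (WeakDual.toStrongDual ⁻¹' kmsFace x ω :
      Set (WeakDual ℂ (uniformRoeAlgebra (BranchingTree n)))) =
      {φ | (((∀ a, 0 ≤ φ (star a * a)) ∧ φ 1 = 1) ∧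
        ∀ a b F, IsEntireExtension (roeFlow height) b F →
          φ (a * F (Complex.I * (Real.log n : ℝ))) = φ (b * a)) ∧
        (∀ S ∈ ω, φ (roeProj (levelSet n S)) = 1) ∧ ∀ k, φ (roeProj (branchCone x k)) = 1} := rfl
  rw [h]
  simp only [Set.ofPred_and, Set.ofPred_forall]
  refine IsClosed.inter (IsClosed.inter (IsClosed.inter ?_ ?_) ?_) (IsClosed.inter ?_ ?_)
  · exact isClosed_iInter fun a => isClosed_le continuous_const (hev _)
  · exact isClosed_eq (hev _) continuous_const
  · exact isClosed_iInter fun a => isClosed_iInter fun b => isClosed_iInter fun F =>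
      isClosed_iInter fun _ => isClosed_eq (hev _) (hev _)
  · exact isClosed_iInter fun S => isClosed_iInter fun _ => isClosed_eq (hev _) continuous_const
  · exact isClosed_iInter fun k => isClosed_eq (hev _) continuous_const

end BranchingTree

theorem WeakDual.locallyConvexSpace_real (E : Type*) [SeminormedAddCommGroup E] [NormedSpace ℂ E] :
    LocallyConvexSpace ℝ (WeakDual ℂ E) :=
  inferInstanceAs (LocallyConvexSpace ℝ (WeakBilin (topDualPairing ℂ E)))

/-- The Krein-Milman lemma for weak-* compact sets of functionals. -/
theorem exists_mem_extremePoints_of_isClosed {E : Type*} [SeminormedAddCommGroup E]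
    [NormedSpace ℂ E] {K : Set (E →L[ℂ] ℂ)} (hne : K.Nonempty) {C : ℝ} (hC : ∀ φ ∈ K, ‖φ‖ ≤ C)
    (hK : IsClosed (WeakDual.toStrongDual ⁻¹' K : Set (WeakDual ℂ E))) :
    ∃ φ, φ ∈ K.extremePoints ℝ := by
  have := WeakDual.locallyConvexSpace_real E
  have hb : Bornology.IsBounded (WeakDual.toStrongDual ⁻¹' K : Set (WeakDual ℂ E)) :=
    (isBounded_iff_forall_norm_le (E := StrongDual ℂ E)).2 ⟨C, hC⟩
  have hcomp := WeakDual.isCompact_of_bounded_of_closed hb hK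
  obtain ⟨φ, hφ⟩ := hcomp.extremePoints_nonempty hne
  exact ⟨WeakDual.toStrongDual φ, hφ⟩

namespace BranchingTree

variable {n : ℕ}

theorem exists_mem_extremeKMSStates_of_ultrafilter (hn : 1 ≤ n) (x : ℕ → Fin n)
    {ω : Ultrafilter ℕ} (hω : (ω : Filter ℕ) ≤ Filter.atTop) :
    ∃ φ ∈ extremeKMSStates n (Real.log n), φ ∈ kmsFace x ω := by
  obtain ⟨φ, hφ⟩ := exists_mem_extremePoints_of_isClosed (nonempty_kmsFace hn x hω)
    (fun φ hφ => norm_le_two_of_mem_kmsStates hφ.1) (isClosed_preimage_kmsFace x ω)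
  exact ⟨φ, (isExtreme_kmsFace x ω).extremePoints_subset_extremePoints hφ, hφ.1⟩

/-- A set separating two ultrafilters would give two disjoint level sets of mass 1. -/
theorem eq_of_mem_kmsFace {x : ℕ → Fin n} {ω ω' : Ultrafilter ℕ}
    {φ : uniformRoeAlgebra (BranchingTree n) →L[ℂ] ℂ} (h : φ ∈ kmsFace x ω)
    (h' : φ ∈ kmsFace x ω') : ω = ω' := by
  by_contra hne
  obtain ⟨S, hS, hS'⟩ : ∃ S, S ∈ ω ∧ S ∉ ω' := by
    by_contra! hall
    exact hne (Ultrafilter.eq_of_le hall).symm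
  have hd : Disjoint (levelSet n S) (levelSet n Sᶜ) :=
    Set.disjoint_left.2 fun y hy hy' => hy' hy
  exact not_apply_eq_one_of_disjoint h.1 hd (h.2.1 S hS)
    (h'.2.1 Sᶜ (Ultrafilter.compl_mem_iff_notMem.2 hS'))

end BranchingTree

/-! ### Cardinalities -/

section Ultrafilters

/-- The pairs `(N, 𝒜)` such that `A ∩ {0, …, N - 1} ∈ 𝒜`. These sets form an independent family
indexed by the sets `A` of natural numbers. -/
def independentSet (A : Set ℕ) : Set (ℕ × Finset (Finset ℕ)) := by
  classical exact {p | (Finset.range p.1).filter (· ∈ A) ∈ p.2}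

theorem exists_mem_independentSet_iff (P : Set (Set ℕ)) (T : Finset (Set ℕ)) :
    ∃ p : ℕ × Finset (Finset ℕ), T.card ≤ p.1 ∧ ∀ A ∈ T, p ∈ independentSet A ↔ A ∈ P := by
  classical
  -- For large N the finitely many members of T have distinct traces on {0, …, N - 1}; the traces of
  -- those in P then form the second coordinate.
  have h1 : ∀ᶠ N in Filter.atTop, ∀ A ∈ T, ∀ B ∈ T,
      (Finset.range N).filter (· ∈ A) = (Finset.range N).filter (· ∈ B) → A = B := by
    refine (Filter.eventually_all_finset T).2 fun A _ => (Filter.eventually_all_finset T).2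
      fun B _ => ?_
    by_cases hAB : A = B
    · exact Filter.Eventually.of_forall fun _ _ => hAB
    · obtain ⟨k, hk⟩ : ∃ k, ¬(k ∈ A ↔ k ∈ B) := by
        by_contra! h
        exact hAB (Set.ext h)
      filter_upwards [Filter.eventually_gt_atTop k] with N hN h
      refine absurd ?_ hk
      have := Finset.ext_iff.1 h k
      simpa [hN] using this
  obtain ⟨N, hN1, hN2⟩ := (h1.and (Filter.eventually_ge_atTop T.card)).exists
  refine ⟨(N, (T.filter (· ∈ P)).image fun A => (Finset.range N).filter (· ∈ A)), hN2,
    fun A hA => ?_⟩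
  change (Finset.range N).filter (· ∈ A) ∈ (T.filter (· ∈ P)).image _ ↔ A ∈ P
  rw [Finset.mem_image]
  constructor
  · rintro ⟨B, hB, hBA⟩
    rw [Finset.mem_filter] at hB
    rw [← hN1 B hB.1 A hA hBA]
    exact hB.2
  · exact fun hP => ⟨A, Finset.mem_filter.2 ⟨hA, hP⟩, rfl⟩

/-- The witnesses for finite T, taken along the directed set of all T, decide every A as P does; an
ultrafilter finer than the image of this net keeps these decisions. -/
theorem exists_ultrafilter_independentSet (P : Set (Set ℕ)) :
    ∃ ω : Ultrafilter (ℕ × Finset (Finset ℕ)), (ω : Filter (ℕ × Finset (Finset ℕ))) ≤ Filter.cofinite ∧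
      ∀ A, independentSet A ∈ ω ↔ A ∈ P := by
  classical
  choose d hd1 hd2 using exists_mem_independentSet_iff P
  have hmem : ∀ A, ∀ᶠ p in (Filter.atTop.map d : Filter (ℕ × Finset (Finset ℕ))),
      p ∈ independentSet A ↔ A ∈ P := fun A => by
    rw [Filter.eventually_map]
    filter_upwards [Filter.eventually_ge_atTop {A}] with T hT
    exact hd2 T A (hT (Finset.mem_singleton_self A))
  have hω := Ultrafilter.of_le (Filter.atTop.map d : Filter (ℕ × Finset (Finset ℕ)))
  refine ⟨Ultrafilter.of (Filter.atTop.map d), hω.trans ?_, fun A => ?_⟩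
  · refine Filter.le_cofinite_iff_eventually_ne.2 fun p => ?_
    rw [Filter.eventually_map]
    -- Once T has more than p.1 members, the bound `T.card ≤ (d T).1` excludes d T = p, so the net
    -- leaves every point.
    obtain ⟨T₀, hT₀⟩ := Infinite.exists_subset_card_eq (Set ℕ) (p.1 + 1)
    filter_upwards [Filter.eventually_ge_atTop T₀] with T hT h
    have h1 := Finset.card_le_card hT
    have h2 := hd1 T
    rw [h] at h2
    omega
  · have h := (hmem A).filter_mono hω
    constructor
    · intro hA
      obtain ⟨p, hp1, hp2⟩ := (h.and hA).exists
      exact hp1.1 hp2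
    · intro hA
      filter_upwards [h] with p hp using hp.2 hA

theorem two_power_two_power_aleph0_le_mk_ultrafilter :
    (2 : Cardinal) ^ ((2 : Cardinal) ^ Cardinal.aleph0) ≤
      Cardinal.mk {ω : Ultrafilter ℕ // (ω : Filter ℕ) ≤ Filter.atTop} := by
  have e : (ℕ × Finset (Finset ℕ)) ≃ ℕ := Denumerable.eqv _
  choose ω hω1 hω2 using exists_ultrafilter_independentSet
  have hle : ∀ P, ((ω P).map e : Filter ℕ) ≤ Filter.atTop := fun P => by
    rw [← Nat.cofinite_eq_atTop]
    exact (Filter.map_mono (hω1 P)).trans e.injective.tendsto_cofinite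
  have hinj : Function.Injective
      (fun P => (⟨(ω P).map e, hle P⟩ : {ω : Ultrafilter ℕ // (ω : Filter ℕ) ≤ Filter.atTop})) := by
    intro P Q h
    have h1 : (ω P).map e = (ω Q).map e := congrArg Subtype.val h
    have h2 : ω P = ω Q := Ultrafilter.coe_injective (Filter.map_injective e.injective
      (congrArg (fun u : Ultrafilter ℕ => (u : Filter ℕ)) h1))
    ext A
    rw [← hω2 P A, ← hω2 Q A, h2]
  have := Cardinal.mk_le_of_injective hinj
  rwa [Cardinal.mk_set, Cardinal.mk_set, Cardinal.mk_nat] at this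

end Ultrafilters

/-! ### Upper bounds on cardinalities, and the final count -/

theorem mk_uniformRoeAlgebra_le (X : Type) [MetricSpace X] [Countable X] :
    Cardinal.mk (uniformRoeAlgebra X) ≤ Cardinal.continuum := by
  have hinj : Function.Injective
      (fun (a : uniformRoeAlgebra X) (p : X × X) => roeEntry p.1 p.2 a) := fun a b h =>
    roeEntry_ext fun x y => congrFun h (x, y)
  refine (Cardinal.mk_le_of_injective hinj).trans ?_
  rw [Cardinal.mk_arrow, Cardinal.lift_id, Cardinal.lift_id, Cardinal.mk_complex]
  exact (Cardinal.power_le_power_left Cardinal.continuum_ne_zero Cardinal.mk_le_aleph0).trans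
    Cardinal.continuum_power_aleph0.le

/-- Countable matrices bound the algebra by the continuum 𝔠, so there are at most 𝔠^𝔠 = 2^𝔠
functionals, continuous or not. -/
theorem mk_dual_uniformRoeAlgebra_le (X : Type) [MetricSpace X] [Countable X] :
    Cardinal.mk (uniformRoeAlgebra X →L[ℂ] ℂ) ≤
      (2 : Cardinal) ^ ((2 : Cardinal) ^ Cardinal.aleph0) := by
  refine (Cardinal.mk_le_of_injective (DFunLike.coe_injective
    (F := uniformRoeAlgebra X →L[ℂ] ℂ))).trans ?_
  rw [Cardinal.mk_arrow, Cardinal.lift_id, Cardinal.lift_id, Cardinal.mk_complex]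
  refine (Cardinal.power_le_power_left Cardinal.continuum_ne_zero
    (mk_uniformRoeAlgebra_le X)).trans ?_
  rw [Cardinal.power_self_eq Cardinal.aleph0_le_continuum, Cardinal.two_power_aleph0]

namespace BranchingTree

variable {n : ℕ}

theorem mk_extremeKMSStates_concentratedOn (hn : 1 ≤ n) (x : ℕ → Fin n) :
    Cardinal.mk {φ : uniformRoeAlgebra (BranchingTree n) →L[ℂ] ℂ //
      φ ∈ extremeKMSStates n (Real.log n) ∧ ConcentratedOn φ x} =
      (2 : Cardinal) ^ ((2 : Cardinal) ^ Cardinal.aleph0) := by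
  refine le_antisymm ((Cardinal.mk_subtype_le _).trans (mk_dual_uniformRoeAlgebra_le _))
    (two_power_two_power_aleph0_le_mk_ultrafilter.trans ?_)
  choose φ hφ1 hφ2 using fun ω : {ω : Ultrafilter ℕ // (ω : Filter ℕ) ≤ Filter.atTop} =>
    exists_mem_extremeKMSStates_of_ultrafilter hn x ω.2
  refine Cardinal.mk_le_of_injective (f := fun ω => ⟨φ ω, hφ1 ω, (hφ2 ω).2.2⟩) fun ω ω' h => ?_
  have h' : φ ω = φ ω' := congrArg Subtype.val h
  exact Subtype.ext (eq_of_mem_kmsFace (hφ2 ω) (h' ▸ hφ2 ω'))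

theorem mk_extremeKMSStates (hn : 1 ≤ n) :
    Cardinal.mk (extremeKMSStates n (Real.log n)) =
      (2 : Cardinal) ^ ((2 : Cardinal) ^ Cardinal.aleph0) := by
  refine le_antisymm ((Cardinal.mk_set_le _).trans (mk_dual_uniformRoeAlgebra_le _)) ?_
  rw [← mk_extremeKMSStates_concentratedOn hn fun _ => ⟨0, hn⟩]
  exact Cardinal.mk_le_of_injective (f := fun φ => ⟨φ.1, φ.2.1⟩) fun φ ψ h =>
    Subtype.ext (Subtype.mk.inj h)

theorem kmsStates_nonempty_iff (hn : 1 ≤ n) (β : ℝ) :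
    (kmsStates n β).Nonempty ↔ Real.log n ≤ β := by
  refine ⟨fun ⟨φ, hφ⟩ => (isConformal_of_mem_kmsStates hφ).log_le hn, fun h => ?_⟩
  rcases h.eq_or_lt with rfl | h
  -- At the critical temperature any branch and any free ultrafilter produce a state.
  · obtain ⟨m, hm, -⟩ := exists_isConformal_of_ultrafilter hn (fun _ => ⟨0, hn⟩)
      (Nat.hyperfilter_le_atTop)
    exact ⟨_, hm.comp_roeExpect_mem_kmsStates⟩
  · exact ⟨_, (isConformal_gibbs hn h).comp_roeExpect_mem_kmsStates⟩

end BranchingTree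

end

theorem theorem1p9 (n : ℕ) (hn : 1 ≤ n) :
    (∀ β : ℝ, (BranchingTree.kmsStates n β).Nonempty ↔ Real.log n ≤ β) ∧
    (∀ β : ℝ, Real.log n < β →
      ∃ φ : uniformRoeAlgebra (BranchingTree n) →L[ℂ] ℂ,
        BranchingTree.kmsStates n β = {φ} ∧
        IsStronglyContinuous φ ∧
        ∀ a : uniformRoeAlgebra (BranchingTree n),
          HasSum (fun y : BranchingTree n =>
            matEntry (a : BEll2 (BranchingTree n)) y y *
              ((Real.exp (-β * y.length) - n * Real.exp (-β * (y.length + 1)) : ℝ) : ℂ))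
            (φ a)) ∧
    (∀ φ ∈ BranchingTree.kmsStates n (Real.log n), VanishesOnCompacts φ) ∧
    (∀ φ ∈ BranchingTree.extremeKMSStates n (Real.log n),
      ∃! x : ℕ → Fin n, BranchingTree.ConcentratedOn φ x) ∧
    (∀ x : ℕ → Fin n,
      Cardinal.mk {φ : uniformRoeAlgebra (BranchingTree n) →L[ℂ] ℂ //
        φ ∈ BranchingTree.extremeKMSStates n (Real.log n) ∧
          BranchingTree.ConcentratedOn φ x} = (2 : Cardinal) ^ ((2 : Cardinal) ^ Cardinal.aleph0)) ∧
    Cardinal.mk (BranchingTree.extremeKMSStates n (Real.log n)) =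
      (2 : Cardinal) ^ ((2 : Cardinal) ^ Cardinal.aleph0) :=
  ⟨BranchingTree.kmsStates_nonempty_iff hn,
    fun _ hβ => BranchingTree.exists_kmsStates_eq_singleton hn hβ,
    fun _ hφ => BranchingTree.vanishesOnCompacts_of_mem_kmsStates hn hφ,
    fun _ hφ => BranchingTree.existsUnique_concentratedOn hn hφ,
    BranchingTree.mk_extremeKMSStates_concentratedOn hn,
    BranchingTree.mk_extremeKMSStates hn⟩
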